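/- **Lemma 2.6.** Let $d\ge 1$ and $0<\lambda\le\Lambda$, and for a symmetric $d\times d$ matrix $X$ put $$\mathcal M^+(X)=\sup\{-\operatorname{tr}(AX)\;:\;A\text{ symmetric},\ \lambda I\le A\le\Lambda I\}.$$ Let $Q\subseteq\mathbb R^{d}\times\mathbb R$ be bounded and open, and let $u\in C(Q)$ satisfy $$u_t+\mathcal M^+(D^2u)\ge -1\quad\text{in }Q$$ in the viscosity sense. Define the monotone envelope of $u$ (with values in $[-\infty,\infty]$, the supremum of the empty set being $-\infty$) by $$\Gamma^u(x,t)=\sup\{p\cdot x+h\;:\;(p,h)\in\mathbb R^d\times\mathbb R,\ p\cdot y+h\le u(y,s)\ \text{ for all }(y,s)\in Q\text{ with }s\le t\},$$ and the parabolic subdifferential of $\Gamma^u$ over $Q$ by $$\mathcal P(Q;\Gamma^u)=\Big\{(p,h)\in\mathbb R^d\times\mathbb R\;:\;\exists\,(x_0,t_0)\in Q,\ \min_{(x,s)\in Q,\ s\le t_0}\big(\Gamma^u(x,s)-p\cdot x\big)=\Gamma^u(x_0,t_0)-p\cdot x_0=h\Big\}.$$ Then $$|\mathcal P(Q;\Gamma^u)|\le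 C\,\big|\{u=\Gamma^u\}\cap Q\big|,$$ where $|\cdot|$ is Lebesgue (outer) measure on $\mathbb R^{d+1}$ and the constant $C$ depends only on $\lambda$ and $d$ (in particular not on $\Lambda$, $Q$ or $u$). -/

import Mathlib

open Set Filter Topology MeasureTheory
open scoped NNReal ENNReal

noncomputable section

/-- Space-time `ℝ^d × ℝ`; a point is `z = (x, t)`. The same space carries the pairs `(p, h)`. -/
abbrev SpaceTime (d : ℕ) : Type := EuclideanSpace ℝ (Fin d) × ℝ

/-- Pucci's maximal operator (with the paper's sign convention)
`M⁺(X) = sup { - tr (A X) : A symmetric, lam • I ≤ A ≤ Lam • I }`. -/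
def pucciMax {d : ℕ} (lam Lam : ℝ) (X : Matrix (Fin d) (Fin d) ℝ) : ℝ :=
  sSup {r : ℝ | ∃ A : Matrix (Fin d) (Fin d) ℝ, A.IsSymm ∧
    (A - lam • (1 : Matrix (Fin d) (Fin d) ℝ)).PosSemidef ∧
    (Lam • (1 : Matrix (Fin d) (Fin d) ℝ) - A).PosSemidef ∧
    r = - (A * X).trace}

/-- `(a, p, X)` lies in the parabolic subjet of `u` at `z₀ = (x₀, t₀)` relative to `Q`:
`X` is symmetric and, as `Q ∋ (x, t) → (x₀, t₀)`,
`u (x, t) ≥ u (x₀, t₀) + a (t - t₀) + p · (x - x₀) + ½ (x - x₀) · X (x - x₀)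
  - o(|t - t₀| + |x - x₀|²)`. -/
def IsParabolicSubjet {d : ℕ} (Q : Set (SpaceTime d)) (u : SpaceTime d → ℝ) (z₀ : SpaceTime d)
    (a : ℝ) (p : EuclideanSpace ℝ (Fin d)) (X : Matrix (Fin d) (Fin d) ℝ) : Prop :=
  X.IsSymm ∧ ∀ ε : ℝ, 0 < ε → ∀ᶠ z in 𝓝[Q] z₀,
    u z₀ + a * (z.2 - z₀.2) + inner ℝ p (z.1 - z₀.1)
      + (1 / 2) * inner ℝ (z.1 - z₀.1) (Matrix.toEuclideanCLM (𝕜 := ℝ) X (z.1 - z₀.1))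
      - ε * (|z.2 - z₀.2| + ‖z.1 - z₀.1‖ ^ 2) ≤ u z

/-- `u_t + F(D²u) ≥ ℓ` in `Q` in the viscosity sense (definition through parabolic subjets). -/
def IsViscositySupersolution {d : ℕ} (Q : Set (SpaceTime d))
    (F : Matrix (Fin d) (Fin d) ℝ → ℝ) (ℓ : ℝ) (u : SpaceTime d → ℝ) : Prop :=
  ∀ z₀ ∈ Q, ∀ (a : ℝ) (p : EuclideanSpace ℝ (Fin d)) (X : Matrix (Fin d) (Fin d) ℝ),
    IsParabolicSubjet Q u z₀ a p X → ℓ ≤ a + F X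

/-- The monotone envelope of `u` over `Q`,
`Γ^u (x, t) = sup { p · x + h : p · y + h ≤ u (y, s) for all (y, s) ∈ Q with s ≤ t }`.
It is extended-real valued, as there need not be any admissible `(p, h)` (then it is `-∞`). -/
def monotoneEnvelope {d : ℕ} (Q : Set (SpaceTime d)) (u : SpaceTime d → ℝ)
    (z : SpaceTime d) : EReal :=
  sSup {r : EReal | ∃ (p : EuclideanSpace ℝ (Fin d)) (h : ℝ),
    (∀ y ∈ Q, y.2 ≤ z.2 → inner ℝ p y.1 + h ≤ u y) ∧ r = ((inner ℝ p z.1 + h : ℝ) : EReal)}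

/-- The parabolic subdifferential of `w` at `z₀ = (x₀, t₀)`, relative to the domain `Q`: all
`(p, h) ∈ ℝ^d × ℝ` with
`min_{(x, s) ∈ Q, s ≤ t₀} (w (x, s) - p · x) = w (x₀, t₀) - p · x₀ = h`. -/
def parabolicSubdiffAt {d : ℕ} (Q : Set (SpaceTime d)) (w : SpaceTime d → EReal)
    (z₀ : SpaceTime d) : Set (SpaceTime d) :=
  {ph | w z₀ - ((inner ℝ ph.1 z₀.1 : ℝ) : EReal) = (ph.2 : EReal) ∧
    ∀ z ∈ Q, z.2 ≤ z₀.2 → (ph.2 : EReal) ≤ w z - ((inner ℝ ph.1 z.1 : ℝ) : EReal)}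

/-- `P(Q'; w)`, the union of the parabolic subdifferentials of `w` (relative to `Q`) at the points
of `Q' ⊆ Q`. -/
def parabolicSubdiff {d : ℕ} (Q : Set (SpaceTime d)) (w : SpaceTime d → EReal)
    (Q' : Set (SpaceTime d)) : Set (SpaceTime d) :=
  ⋃ z₀ ∈ Q', parabolicSubdiffAt Q w z₀

/-- The contact set `{u = Γ^u} ∩ Q`. -/
def contactSet {d : ℕ} (Q : Set (SpaceTime d)) (u : SpaceTime d → ℝ) : Set (SpaceTime d) :=
  {z | (u z : EReal) = monotoneEnvelope Q u z} ∩ Q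

end

/-!
A pair `(p, h)` in the subdifferential of the envelope gives, up to a null set of pairs, an affine
function `x ↦ p · x + h` lying below `u` on the past of some `w ∈ Q` and equal to `u` at `w`; such a
`w` is a contact point. If `u` were `C²`, then `p = Du(w)`, `h = u(w) - Du(w) · x`, and the map
`w ↦ (p, h)` would have Jacobian `|u_t det D²u|`. At contact points `D²u ≥ 0` and `u_t ≤ 0`, so that
the supersolution inequality reads `|u_t| + lam tr D²u ≤ 1`, which bounds the Jacobian in terms of
`lam` and `d` only. The proof makes this rigorous for continuous `u`.

*Null sets.* The pairs lost are those whose contact with `u` is not at a unique point of `Q`. The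
sets `minorants Q u t` decrease in `t`; a pair touching at two different places of space is a corner
of one of them, and the corners, although they come from uncountably many `t`, form a null set
because any two of them are comparable (`volume_setOf_two_normals`). A pair touching over the same
place at two different times is maximal in `minorants Q u t` for a rational `t`
(`volume_maximal_minorants`). Both facts follow from `addHaar_eq_zero_of_forall_sub`: a set whose
differences avoid an open cone around a direction is null.

*Regularization.* On a compact `K ⊆ Q` the condition "below `u` for times `≤ t`" is relaxed to
"below `u + N ((s - σ)⁺)²`", with `σ` chosen such that contact occurs at the same level `h`
(`exists_penalized_contact`); off the null set the contact points converge as `N → ∞`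
(`volume_minorants_touching_le`). For fixed `N`, the affine functions below `u + N t²` on `K` have
a supremum `W` that is finite and convex, and the Moreau envelope `g` of `W - N t²` with parameter
`1 / (4N)` has a Lipschitz gradient (`lipschitzWith_prox`, `hasFDerivAt_moreau`). A contact point `w`
with slope `(p, q)` corresponds to `z = w + (p, q) / (4N)`, where `∇g = (p, q)`, and `(p, h)` is the
value at `z` of the locally Lipschitz map `slopeHeight`. By Rademacher's theorem `g` is twice
differentiable at almost every `z`, and there its second order expansion is a parabolic subjet of
`u` at `w` (`isParabolicSubjet_of_touching`). The mixed second derivatives that enter the Jacobian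
of `slopeHeight` are controlled since `D²g + 4N e_t ⊗ e_t` is positive semidefinite, and its
determinant, after rescaling time, is at most a power of its trace
(`abs_det_le_of_hessian_bounds`). The area formula gives the estimate for fixed `N` and `K`
(`volume_contact_le`).

*Conclusion.* The constant does not depend on `N` or `K`, so `N → ∞`, `K ↑ Q`, and outer regularity
of the measure on the contact set finish the proof.
-/

section

variable {d : ℕ}

/-! ### Sets whose differences avoid a cone -/

open scoped Pointwise in
/-- A set is null if its differences avoid a set `{F < 0}` that contains a ray: the translates of the
set by small vectors of this ray are pairwise disjoint. Measurability is not needed, because the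
condition passes to the closure. -/
theorem addHaar_eq_zero_of_forall_sub {E : Type*} [NormedAddCommGroup E] [NormedSpace ℝ E]
    [FiniteDimensional ℝ E] [MeasurableSpace E] [BorelSpace E] (μ : Measure E)
    [μ.IsAddHaarMeasure] {S : Set E} {F : E → ℝ} (hF : Continuous F) {e : E}
    (he : ∀ t : ℝ, 0 < t → F (t • e) < 0) (hS : ∀ z ∈ S, ∀ z' ∈ S, 0 ≤ F (z' - z)) :
    μ S = 0 := by
  have key : ∀ n : ℕ, μ (S ∩ Metric.closedBall 0 n) = 0 := by
    intro n
    have hbdd : Bornology.IsBounded (closure (S ∩ Metric.closedBall 0 (n : ℝ))) :=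
      (Metric.isBounded_closedBall.subset inter_subset_right).closure
    have hcl : ∀ z ∈ closure (S ∩ Metric.closedBall 0 (n : ℝ)),
        ∀ z' ∈ closure (S ∩ Metric.closedBall 0 (n : ℝ)), 0 ≤ F (z' - z) := by
      have hc : IsClosed {zz : E × E | 0 ≤ F (zz.2 - zz.1)} :=
        isClosed_le continuous_const (by fun_prop)
      have := closure_minimal (s := (S ∩ Metric.closedBall 0 (n : ℝ)) ×ˢ
        (S ∩ Metric.closedBall 0 (n : ℝ))) (fun zz hz => hS _ hz.1.1 _ hz.2.1) hc
      rw [closure_prod_eq] at this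
      intro z hz z' hz'
      exact this (mk_mem_prod hz hz')
    refine measure_mono_null subset_closure
      (Measure.addHaar_eq_zero_of_disjoint_translates μ (fun k : ℕ => (1 / ((k : ℝ) + 1)) • e)
        ?_ ?_ isClosed_closure.measurableSet)
    · refine (Metric.isBounded_closedBall (x := (0 : E)) (r := ‖e‖)).subset ?_
      rintro _ ⟨k, rfl⟩
      simp only [mem_closedBall_zero_iff, norm_smul]
      have h1 : ‖(1 / ((k : ℝ) + 1))‖ ≤ 1 := by
        rw [Real.norm_of_nonneg (by positivity)]
        rw [div_le_one (by positivity)]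
        linarith [k.cast_nonneg (α := ℝ)]
      exact mul_le_of_le_one_left (norm_nonneg _) h1
    · have hlt : ∀ i j : ℕ, i < j → Disjoint
          (({(1 / ((i : ℝ) + 1)) • e} : Set E) + closure (S ∩ Metric.closedBall 0 (n : ℝ)))
          (({(1 / ((j : ℝ) + 1)) • e} : Set E) + closure (S ∩ Metric.closedBall 0 (n : ℝ))) := by
        intro i j hij
        rw [Set.disjoint_left]
        rintro x hx hx'
        simp only [singleton_add, image_add_left, mem_preimage] at hx hx'
        have h0 := hcl _ hx _ hx'
        have hpos : (0 : ℝ) < 1 / ((i : ℝ) + 1) - 1 / ((j : ℝ) + 1) := by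
          have : (i : ℝ) < j := by exact_mod_cast hij
          rw [sub_pos]
          exact one_div_lt_one_div_of_lt (by positivity) (by linarith)
        have h1 := he _ hpos
        have h2 : (-((1 / ((j : ℝ) + 1)) • e) + x) - (-((1 / ((i : ℝ) + 1)) • e) + x)
          = (1 / ((i : ℝ) + 1) - 1 / ((j : ℝ) + 1)) • e := by
          rw [sub_smul]; abel
        rw [h2] at h0
        linarith
      intro i j hij
      rcases lt_or_gt_of_ne hij with h | h
      · exact hlt i j h
      · exact (hlt j i h).symm
  refine measure_mono_null (fun z hz => ?_) (measure_iUnion_null key)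
  obtain ⟨n, hn⟩ := exists_nat_ge ‖z‖
  exact mem_iUnion.2 ⟨n, hz, by simpa using hn⟩


/-- Instance search does not see that the volume on `SpaceTime d` is a product measure. -/
instance isAddHaarMeasure_volume_spaceTime : (volume : Measure (SpaceTime d)).IsAddHaarMeasure :=
  inferInstanceAs
    ((volume : Measure (EuclideanSpace ℝ (Fin d))).prod (volume : Measure ℝ)).IsAddHaarMeasure

/-! ### Exceptional pairs -/

/-- For a decreasing family of sets `B t`, the pairs in some `B t` at which two different functionals
`(q, k) ↦ q · x + k` are maximal on `B t` form a null set.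

For `x`, `y` close to fixed distinct points `x̂`, `ŷ`, two such pairs differ by some `(Δp, Δh)` with
`|Δp · v| ≤ |Δh + Δp · c| + η |Δp|`, where `c = (x̂ + ŷ) / 2` and `v = (ŷ - x̂) / 2`: the one belonging
to the larger `t` lies below both hyperplanes through the other one. Hence the differences avoid a
cone around the direction `(v, - v · c)`. -/
theorem volume_setOf_two_normals {B : ℝ → Set (SpaceTime d)} (hB : Antitone B) :
    volume {ph : SpaceTime d | ∃ t, ph ∈ B t ∧ ∃ x y : EuclideanSpace ℝ (Fin d), x ≠ y ∧
      (∀ qk ∈ B t, inner ℝ qk.1 x + qk.2 ≤ inner ℝ ph.1 x + ph.2) ∧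
      (∀ qk ∈ B t, inner ℝ qk.1 y + qk.2 ≤ inner ℝ ph.1 y + ph.2)} = 0 := by
  set D : ℕ → EuclideanSpace ℝ (Fin d) := TopologicalSpace.denseSeq _ with hD
  have hDd : DenseRange D := TopologicalSpace.denseRange_denseSeq _
  have key : ∀ i j : ℕ, D i ≠ D j → volume {ph : SpaceTime d | ∃ t, ph ∈ B t ∧
      ∃ x y : EuclideanSpace ℝ (Fin d), ‖x - D i‖ ≤ ‖D j - D i‖ / 4 ∧
      ‖y - D j‖ ≤ ‖D j - D i‖ / 4 ∧
      (∀ qk ∈ B t, inner ℝ qk.1 x + qk.2 ≤ inner ℝ ph.1 x + ph.2) ∧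
      (∀ qk ∈ B t, inner ℝ qk.1 y + qk.2 ≤ inner ℝ ph.1 y + ph.2)} = 0 := by
    intro i j hij
    have hr : 0 < ‖D j - D i‖ := norm_pos_iff.2 (sub_ne_zero.2 hij.symm)
    refine addHaar_eq_zero_of_forall_sub volume
      (F := fun z : SpaceTime d => |z.2 + inner ℝ z.1 ((1 / 2 : ℝ) • (D i + D j))|
        + ‖D j - D i‖ / 4 * ‖z.1‖ - |inner ℝ z.1 ((1 / 2 : ℝ) • (D j - D i))|) (by fun_prop)
      (e := ((1 / 2 : ℝ) • (D j - D i),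
        - inner ℝ ((1 / 2 : ℝ) • (D j - D i)) ((1 / 2 : ℝ) • (D i + D j)))) ?_ ?_
    · intro t ht
      simp only [Prod.smul_mk, inner_smul_left, inner_smul_right, norm_smul,
        real_inner_self_eq_norm_sq, smul_eq_mul, conj_trivial, Real.norm_eq_abs, abs_of_pos ht]
      rw [abs_of_nonneg (a := (1 / 2 * (t * (1 / 2 * ‖D j - D i‖ ^ 2)))) (by positivity)]
      rw [show t * -(1/2 * (1/2 * inner ℝ (D j - D i) (D i + D j))) +
        1/2 * (t * (1/2 * inner ℝ (D j - D i) (D i + D j))) = 0 by ring]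
      have : 0 < t * ‖D j - D i‖ ^ 2 := by positivity
      norm_num
      nlinarith
    · have main : ∀ z z' : SpaceTime d, ∀ x y : EuclideanSpace ℝ (Fin d),
          ‖x - D i‖ ≤ ‖D j - D i‖ / 4 → ‖y - D j‖ ≤ ‖D j - D i‖ / 4 →
          inner ℝ z'.1 x + z'.2 ≤ inner ℝ z.1 x + z.2 →
          inner ℝ z'.1 y + z'.2 ≤ inner ℝ z.1 y + z.2 →
          |inner ℝ (z'.1 - z.1) ((1 / 2 : ℝ) • (D j - D i))| ≤
            -((z'.2 - z.2) + inner ℝ (z'.1 - z.1) ((1 / 2 : ℝ) • (D i + D j)))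
            + ‖D j - D i‖ / 4 * ‖z'.1 - z.1‖ := by
        intro z z' x y hx hy h1 h2
        have e1 : - inner ℝ (z'.1 - z.1) (x - D i) ≤ ‖D j - D i‖ / 4 * ‖z'.1 - z.1‖ := by
          have := abs_le.1 (abs_real_inner_le_norm (z'.1 - z.1) (x - D i))
          nlinarith [norm_nonneg (z'.1 - z.1)]
        have e2 : - inner ℝ (z'.1 - z.1) (y - D j) ≤ ‖D j - D i‖ / 4 * ‖z'.1 - z.1‖ := by
          have := abs_le.1 (abs_real_inner_le_norm (z'.1 - z.1) (y - D j))
          nlinarith [norm_nonneg (z'.1 - z.1)]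
        simp only [inner_sub_left, inner_sub_right, inner_add_right, inner_smul_right] at *
        rw [abs_le]
        constructor <;> linarith
      rintro z ⟨t, hzt, x, y, hx, hy, h1, h2⟩ z' ⟨t', hzt', x', y', hx', hy', h1', h2'⟩
      simp only [Prod.fst_sub, Prod.snd_sub]
      rcases le_total t t' with h | h
      · have := main z z' x y hx hy (h1 _ (hB h hzt')) (h2 _ (hB h hzt'))
        have h3 := neg_le_abs (z'.2 - z.2 + inner ℝ (z'.1 - z.1) ((1 / 2 : ℝ) • (D i + D j)))
        linarith
      · have := main z' z x' y' hx' hy' (h1' _ (hB h hzt)) (h2' _ (hB h hzt))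
        have h3 := le_abs_self (z'.2 - z.2 + inner ℝ (z'.1 - z.1) ((1 / 2 : ℝ) • (D i + D j)))
        rw [← neg_sub z'.1 z.1, ← neg_sub z'.2 z.2, norm_neg, inner_neg_left, inner_neg_left,
          abs_neg] at this
        linarith
  have key' : ∀ i j : ℕ, volume {ph : SpaceTime d | D i ≠ D j ∧ ∃ t, ph ∈ B t ∧
      ∃ x y : EuclideanSpace ℝ (Fin d), ‖x - D i‖ ≤ ‖D j - D i‖ / 4 ∧
      ‖y - D j‖ ≤ ‖D j - D i‖ / 4 ∧
      (∀ qk ∈ B t, inner ℝ qk.1 x + qk.2 ≤ inner ℝ ph.1 x + ph.2) ∧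
      (∀ qk ∈ B t, inner ℝ qk.1 y + qk.2 ≤ inner ℝ ph.1 y + ph.2)} = 0 := by
    intro i j
    by_cases h : D i = D j
    · simp [h]
    · exact measure_mono_null (fun z hz => hz.2) (key i j h)
  refine measure_mono_null ?_ (measure_iUnion_null fun i => measure_iUnion_null (key' i))
  rintro ph ⟨t, hph, x, y, hxy, h1, h2⟩
  have hpos : 0 < ‖y - x‖ / 10 := by
    have := norm_pos_iff.2 (sub_ne_zero.2 hxy.symm); positivity
  obtain ⟨i, hi⟩ := hDd.exists_dist_lt x hpos
  obtain ⟨j, hj⟩ := hDd.exists_dist_lt y hpos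
  rw [dist_eq_norm] at hi hj
  have htri : ‖y - x‖ ≤ ‖y - D j‖ + ‖D j - D i‖ + ‖x - D i‖ := by
    rw [← norm_neg (x - D i)]
    refine le_trans (le_of_eq ?_) (norm_add₃_le)
    congr 1; abel
  refine mem_iUnion.2 ⟨i, mem_iUnion.2 ⟨j, ?_, t, hph, x, y, ?_, ?_, h1, h2⟩⟩
  · intro h
    rw [h] at htri hi
    rw [sub_self, norm_zero] at htri
    linarith
  · linarith
  · linarith

/-- The pairs `(p, h)` such that `p · x + h` lies below `u` on `Q` up to time `t`. -/
def minorants (Q : Set (SpaceTime d)) (u : SpaceTime d → ℝ) (t : ℝ) : Set (SpaceTime d) :=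
  {ph | ∀ z ∈ Q, z.2 ≤ t → inner ℝ ph.1 z.1 + ph.2 ≤ u z}

theorem antitone_minorants (Q : Set (SpaceTime d)) (u : SpaceTime d → ℝ) :
    Antitone (minorants Q u) :=
  fun _ _ hst _ hph z hz hzs => hph z hz (hzs.trans hst)

/-- The pairs that are maximal in `h` at a fixed time form a null set: they are the graph of
`p ↦ inf (u - p · x)`, a Lipschitz function because `Q` is bounded. -/
theorem volume_maximal_minorants {Q : Set (SpaceTime d)} (hQ : Bornology.IsBounded Q)
    (u : SpaceTime d → ℝ) (t : ℝ) :
    volume {ph ∈ minorants Q u t | ∀ h' > ph.2, (ph.1, h') ∉ minorants Q u t} = 0 := by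
  obtain ⟨R, hR⟩ := hQ.exists_norm_le
  refine addHaar_eq_zero_of_forall_sub volume (F := fun z : SpaceTime d => z.2 + R * ‖z.1‖)
    (by fun_prop) (e := (0, -1)) ?_ ?_
  · intro s hs
    simpa using hs
  · rintro z ⟨hz, -⟩ z' ⟨-, hz'⟩
    by_contra! hlt
    refine hz' (z.2 - R * ‖z'.1 - z.1‖) ?_ ?_
    · simp only [Prod.fst_sub, Prod.snd_sub] at hlt
      linarith
    · intro w hw hwt
      have h1 := hz w hw hwt
      have h2 : inner ℝ (z'.1 - z.1) w.1 ≤ R * ‖z'.1 - z.1‖ := by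
        refine (real_inner_le_norm _ _).trans ?_
        rw [mul_comm]
        exact mul_le_mul_of_nonneg_right ((norm_fst_le w).trans (hR w hw)) (norm_nonneg _)
      rw [inner_sub_left] at h2
      simp only
      linarith

/-- A null set of pairs, outside of which a pair can touch `u` at one point only: the first part
consists of the pairs touching (possibly in the limit) above two different places of space, the
second part contains those touching above one place at two different times. -/
def exceptionalPairs (Q : Set (SpaceTime d)) (u : SpaceTime d → ℝ) : Set (SpaceTime d) :=
  {ph : SpaceTime d | ∃ t, ph ∈ minorants Q u t ∧ ∃ x y : EuclideanSpace ℝ (Fin d), x ≠ y ∧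
      (∀ qk ∈ minorants Q u t, inner ℝ qk.1 x + qk.2 ≤ inner ℝ ph.1 x + ph.2) ∧
      (∀ qk ∈ minorants Q u t, inner ℝ qk.1 y + qk.2 ≤ inner ℝ ph.1 y + ph.2)} ∪
  ⋃ t : ℚ, {ph ∈ minorants Q u t | ∀ h' > ph.2, (ph.1, h') ∉ minorants Q u t}

theorem volume_exceptionalPairs {Q : Set (SpaceTime d)} (hQ : Bornology.IsBounded Q)
    (u : SpaceTime d → ℝ) : volume (exceptionalPairs Q u) = 0 :=
  measure_union_null (volume_setOf_two_normals (antitone_minorants Q u))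
    (measure_iUnion_null fun t => volume_maximal_minorants hQ u t)

/-- Up to exceptional pairs, every pair in the parabolic subdifferential of the envelope touches `u`
from below in the past of some point of `Q`. The pair is optimal for the envelope at some
`(x₀, t₀) ∈ Q`, so it touches `u` along a sequence in `Q`, and it is exceptional if the limit of this
sequence lies outside `Q`. -/
theorem parabolicSubdiff_subset {Q : Set (SpaceTime d)} (hQ : Bornology.IsBounded Q)
    {u : SpaceTime d → ℝ} (hu : ContinuousOn u Q) :
    parabolicSubdiff Q (monotoneEnvelope Q u) Q ⊆ exceptionalPairs Q u ∪
      {ph | ∃ w ∈ Q, ph ∈ minorants Q u w.2 ∧ u w = inner ℝ ph.1 w.1 + ph.2} := by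
  rintro ⟨p, h⟩ hph
  simp only [parabolicSubdiff, mem_iUnion] at hph
  obtain ⟨⟨x₀, t₀⟩, hz₀, heq, hmin⟩ := hph
  simp only at heq hmin
  have hle : ∀ z ∈ Q, monotoneEnvelope Q u z ≤ (u z : EReal) := by
    intro z hz
    refine sSup_le ?_
    rintro _ ⟨q, k, hqk, rfl⟩
    exact EReal.coe_le_coe_iff.2 (hqk z hz le_rfl)
  have hmem : (p, h) ∈ minorants Q u t₀ := by
    intro z hz hzt
    have h1 := (hmin z hz hzt).trans (EReal.sub_le_sub (hle z hz) le_rfl)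
    rw [← EReal.coe_sub, EReal.coe_le_coe_iff] at h1
    simp only
    linarith
  have hmax : ∀ qk ∈ minorants Q u t₀, inner ℝ qk.1 x₀ + qk.2 ≤ inner ℝ p x₀ + h := by
    intro qk hqk
    have h1 : ((inner ℝ qk.1 x₀ + qk.2 : ℝ) : EReal) ≤ monotoneEnvelope Q u (x₀, t₀) :=
      le_sSup ⟨qk.1, qk.2, hqk, rfl⟩
    have h2 := (EReal.sub_le_sub h1 (le_refl ((inner ℝ p x₀ : ℝ) : EReal)))
    rw [heq, ← EReal.coe_sub, EReal.coe_le_coe_iff] at h2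
    linarith
  have happrox : ∀ n : ℕ, ∃ w ∈ Q, w.2 ≤ t₀ ∧ u w < inner ℝ p w.1 + (h + 1 / ((n : ℝ) + 1)) := by
    intro n
    by_contra! hcon
    have := hmax (p, h + 1 / ((n : ℝ) + 1)) hcon
    have h2 : (0 : ℝ) < 1 / ((n : ℝ) + 1) := by positivity
    simp only at this
    linarith
  choose w hwQ hwt hwu using happrox
  obtain ⟨w', -, φ, hφ, hlim⟩ := tendsto_subseq_of_bounded hQ hwQ
  have hlim1 : Tendsto (fun n => (w (φ n)).1) atTop (𝓝 w'.1) :=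
    (continuous_fst.tendsto _).comp hlim
  have hlim2 : Tendsto (fun n => (w (φ n)).2) atTop (𝓝 w'.2) :=
    (continuous_snd.tendsto _).comp hlim
  have hw't : w'.2 ≤ t₀ := le_of_tendsto' hlim2 fun n => hwt _
  have hinv : Tendsto (fun n => 1 / ((φ n : ℝ) + 1)) atTop (𝓝 0) :=
    tendsto_one_div_add_atTop_nhds_zero_nat.comp hφ.tendsto_atTop
  have hinner : Tendsto (fun n => inner ℝ p (w (φ n)).1) atTop (𝓝 (inner ℝ p w'.1)) :=
    tendsto_const_nhds.inner hlim1
  have hright : Tendsto (fun n => inner ℝ p (w (φ n)).1 + (h + 1 / ((φ n : ℝ) + 1))) atTop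
      (𝓝 (inner ℝ p w'.1 + (h + 0))) :=
    hinner.add (hinv.const_add h)
  by_cases hw'Q : w' ∈ Q
  · right
    refine ⟨w', hw'Q, antitone_minorants Q u hw't hmem, le_antisymm ?_ (hmem w' hw'Q hw't)⟩
    have hul : Tendsto (fun n => u (w (φ n))) atTop (𝓝 (u w')) :=
      (hu w' hw'Q).tendsto.comp
        (tendsto_nhdsWithin_iff.2 ⟨hlim, Eventually.of_forall fun n => hwQ _⟩)
    have := le_of_tendsto_of_tendsto' hul hright fun n => (hwu (φ n)).le
    simpa using this
  · left
    by_cases hx : x₀ = w'.1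
    · right
      -- `(x₀, w'.2) ∉ Q`, so the limit time is strictly smaller, with a rational time in between.
      have hlt : w'.2 < t₀ := by
        refine lt_of_le_of_ne hw't fun heq' => hw'Q ?_
        have : w' = (x₀, t₀) := Prod.ext hx.symm heq'
        rwa [this]
      obtain ⟨q, hq1, hq2⟩ := exists_rat_btwn hlt
      refine mem_iUnion.2 ⟨q, antitone_minorants Q u hq2.le hmem, fun h' hh' hcon => ?_⟩
      simp only at hh'
      have hev : ∀ᶠ n in atTop, inner ℝ p (w (φ n)).1 + h' ≤
          inner ℝ p (w (φ n)).1 + (h + 1 / ((φ n : ℝ) + 1)) := by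
        filter_upwards [hlim2.eventually_lt_const hq1] with n hn
        exact (hcon _ (hwQ _) hn.le).trans (hwu _).le
      have := le_of_tendsto_of_tendsto (hinner.add_const h') hright hev
      linarith
    · left
      refine ⟨t₀, hmem, x₀, w'.1, hx, hmax, fun qk hqk => ?_⟩
      have := le_of_tendsto_of_tendsto' (((tendsto_const_nhds (x := qk.1)).inner (𝕜 := ℝ) hlim1).add_const qk.2)
        hright fun n => (hqk _ (hwQ _) (hwt _)).trans (hwu _).le
      simpa using this

/-! ### Second order expansion -/

/-- Second order Taylor expansion at a single point of differentiability of the derivative. -/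
theorem eventually_abs_sub_taylor_two_le {E : Type*} [NormedAddCommGroup E] [NormedSpace ℝ E]
    {g : E → ℝ} {g' : E → E →L[ℝ] ℝ} {g'' : E →L[ℝ] E →L[ℝ] ℝ} {z : E}
    (hg : ∀ y, HasFDerivAt g (g' y) y) (hg' : HasFDerivAt g' g'' z) {η : ℝ} (hη : 0 < η) :
    ∀ᶠ y in 𝓝 z,
      |g y - g z - g' z (y - z) - 1 / 2 * g'' (y - z) (y - z)| ≤ η * ‖y - z‖ ^ 2 := by
  have hsymm := second_derivative_symmetric hg hg'
  obtain ⟨r, hr, hball⟩ := Metric.eventually_nhds_iff_ball.1 (hg'.isLittleO.def hη)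
  filter_upwards [Metric.ball_mem_nhds z hr] with y hy
  set k : E → ℝ := fun y => g y - g' z (y - z) - 1 / 2 * g'' (y - z) (y - z) with hk
  have hkd : ∀ x, HasFDerivAt k (g' x - g' z - g'' (x - z)) x := by
    intro x
    have h1 : HasFDerivAt (fun x : E => x - z) (ContinuousLinearMap.id ℝ E) x :=
      (hasFDerivAt_id x).sub_const z
    have h2 : HasFDerivAt (fun x => g'' (x - z)) g'' x :=
      g''.hasFDerivAt.comp x h1
    have h3 := h2.clm_apply h1
    have h4 := ((hg x).sub ((g' z).hasFDerivAt.comp x h1)).sub (h3.const_mul (1 / 2))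
    refine h4.congr_fderiv ?_
    ext v
    have := hsymm v (x - z)
    simp at this ⊢
    linarith
  have hsub : Metric.closedBall z ‖y - z‖ ⊆ Metric.ball z r :=
    Metric.closedBall_subset_ball (by rwa [← dist_eq_norm])
  have := (convex_closedBall z ‖y - z‖).norm_image_sub_le_of_norm_hasFDerivWithin_le
    (f := k) (f' := fun x => g' x - g' z - g'' (x - z)) (C := η * ‖y - z‖)
    (fun x _ => (hkd x).hasFDerivWithinAt)
    (fun x hx => (hball x (hsub hx)).trans
      (mul_le_mul_of_nonneg_left (by simpa [dist_eq_norm] using hx) hη.le))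
    (Metric.mem_closedBall_self (norm_nonneg _))
    (by simp [dist_eq_norm] : y ∈ Metric.closedBall z ‖y - z‖)
  rw [Real.norm_eq_abs] at this
  simp only [hk, sub_self, map_zero, mul_zero, sub_zero] at this
  calc _ = |g y - g' z (y - z) - 1 / 2 * g'' (y - z) (y - z) - g z| := by congr 1; ring
    _ ≤ _ := by rw [sq, ← mul_assoc]; exact this


/-! ### Moreau envelopes in space-time -/

/-- The Euclidean inner product of space-time, as a continuous bilinear form. (`SpaceTime d`
carries the sup norm of its two factors, so it is not an inner product space.) -/
noncomputable def stInner : SpaceTime d →L[ℝ] SpaceTime d →L[ℝ] ℝ :=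
  (innerSL ℝ : EuclideanSpace ℝ (Fin d) →L[ℝ] EuclideanSpace ℝ (Fin d) →L[ℝ] ℝ).bilinearComp
      (ContinuousLinearMap.fst ℝ _ _) (ContinuousLinearMap.fst ℝ _ _) +
    (ContinuousLinearMap.mul ℝ ℝ).bilinearComp
      (ContinuousLinearMap.snd ℝ _ _) (ContinuousLinearMap.snd ℝ _ _)

theorem stInner_apply (a b : SpaceTime d) :
    stInner a b = inner ℝ a.1 b.1 + a.2 * b.2 := by
  simp [stInner]

theorem abs_stInner_le (a b : SpaceTime d) : |stInner a b| ≤ 2 * (‖a‖ * ‖b‖) := by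
  rw [stInner_apply]
  have h1 := abs_real_inner_le_norm a.1 b.1
  have h2 : ‖a.1‖ * ‖b.1‖ ≤ ‖a‖ * ‖b‖ :=
    mul_le_mul (norm_fst_le a) (norm_fst_le b) (norm_nonneg _) (norm_nonneg _)
  have h3 : |a.2 * b.2| ≤ ‖a‖ * ‖b‖ := by
    rw [abs_mul]
    exact mul_le_mul (norm_snd_le a) (norm_snd_le b) (abs_nonneg _) (norm_nonneg _)
  linarith [abs_add_le (inner ℝ a.1 b.1) (a.2 * b.2)]

theorem sq_norm_le_stInner_self (a : SpaceTime d) : ‖a‖ ^ 2 ≤ ‖a.1‖ ^ 2 + a.2 ^ 2 := by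
  rcases max_choice ‖a.1‖ ‖a.2‖ with h | h
  · rw [Prod.norm_def, h]; nlinarith [sq_nonneg a.2]
  · rw [Prod.norm_def, h, Real.norm_eq_abs, sq_abs]; nlinarith [sq_nonneg ‖a.1‖]

theorem sq_norm_add_sq_le (a : SpaceTime d) : ‖a.1‖ ^ 2 + a.2 ^ 2 ≤ 2 * ‖a‖ ^ 2 := by
  have h1 := norm_fst_le a
  have h2 := norm_snd_le a
  rw [← sq_abs a.2, ← Real.norm_eq_abs]
  nlinarith [norm_nonneg a.1, norm_nonneg a.2, norm_nonneg a]

/-- The function of `w` whose minimum defines the Moreau envelope at `z`, with parameter `1 / (4N)`, of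
the semiconvex function `W - N t²` (where `W` is convex). -/
noncomputable def proxObj (N : ℝ) (W : SpaceTime d → ℝ) (z w : SpaceTime d) : ℝ :=
  W w - N * w.2 ^ 2 + 2 * N * (‖z.1 - w.1‖ ^ 2 + (z.2 - w.2) ^ 2)

/-- Minimizers of `proxObj` exist, as the quadratic terms combine to a coercive function of `w`. -/
theorem exists_prox {N : ℝ} (hN : 0 < N) {W : SpaceTime d → ℝ} (hWc : Continuous W) {R : ℝ}
    (hR : ∀ w, -R * (1 + ‖w‖) ≤ W w) :
    ∃ prox : SpaceTime d → SpaceTime d, ∀ z w, proxObj N W z (prox z) ≤ proxObj N W z w := by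
  have : ∀ z, ∃ w₀, ∀ w, proxObj N W z w₀ ≤ proxObj N W z w := by
    intro z
    refine Continuous.exists_forall_le (by unfold proxObj; fun_prop) ?_
    have hlow : ∀ w, ‖w‖ * (N / 2 * ‖w‖ - R) + (-R - 6 * N * z.2 ^ 2 - 2 * N * ‖z.1‖ ^ 2) ≤
        proxObj N W z w := by
      intro w
      have h1 : ‖w.1‖ ^ 2 ≤ 2 * ‖z.1 - w.1‖ ^ 2 + 2 * ‖z.1‖ ^ 2 := by
        have : ‖w.1‖ ≤ ‖z.1 - w.1‖ + ‖z.1‖ := by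
          have := norm_sub_norm_le w.1 z.1
          rw [norm_sub_rev] at this
          linarith
        nlinarith [sq_nonneg (‖z.1 - w.1‖ - ‖z.1‖), norm_nonneg w.1]
      have h2 := sq_norm_le_stInner_self w
      have h3 := hR w
      unfold proxObj
      nlinarith [sq_nonneg (w.2 - 4 * z.2), sq_nonneg ‖w.1‖,
        mul_nonneg hN.le (sq_nonneg (w.2 - 4 * z.2)), mul_le_mul_of_nonneg_left h1 hN.le,
        mul_le_mul_of_nonneg_left h2 hN.le, mul_nonneg hN.le (sq_nonneg ‖w.1‖)]
    refine tendsto_atTop_mono hlow (tendsto_atTop_add_const_right _ _ ?_)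
    have hn := tendsto_norm_cocompact_atTop (E := SpaceTime d)
    exact hn.atTop_mul_atTop₀ (tendsto_atTop_add_const_right _ (-R)
      (hn.const_mul_atTop (by positivity)))
  choose prox hprox using this
  exact ⟨prox, hprox⟩

/-- The objective grows quadratically away from a minimizer, by strong convexity. -/
theorem add_le_proxObj_of_isMin {N : ℝ} {W : SpaceTime d → ℝ}
    (hW : ConvexOn ℝ univ W) {z w : SpaceTime d}
    (hw : ∀ w', proxObj N W z w ≤ proxObj N W z w') (w' : SpaceTime d) :
    proxObj N W z w + (N * (w'.2 - w.2) ^ 2 + 2 * N * ‖w'.1 - w.1‖ ^ 2) ≤ proxObj N W z w' := by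
  set D := proxObj N W z w' - proxObj N W z w with hD
  set A := N * (w'.2 - w.2) ^ 2 + 2 * N * ‖w'.1 - w.1‖ ^ 2 with hA
  have hD0 : 0 ≤ D := sub_nonneg.2 (hw w')
  have key : ∀ τ : ℝ, 0 < τ → τ < 1 → (1 - τ) * A ≤ D := by
    intro τ h0 h1
    have hc := hW.2 (mem_univ w) (mem_univ w') (sub_nonneg.2 h1.le) h0.le (by ring)
    have hm := hw ((1 - τ) • w + τ • w')
    simp only [smul_eq_mul] at hc
    have e1 : ‖z.1 - ((1 - τ) • w.1 + τ • w'.1)‖ ^ 2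
        = (1 - τ) * ‖z.1 - w.1‖ ^ 2 + τ * ‖z.1 - w'.1‖ ^ 2 - τ * (1 - τ) * ‖w'.1 - w.1‖ ^ 2 := by
      have a1 : z.1 - ((1 - τ) • w.1 + τ • w'.1) = (z.1 - w.1) - τ • (w'.1 - w.1) := by
        module
      have a2 : z.1 - w'.1 = (z.1 - w.1) - (w'.1 - w.1) := by abel
      rw [a1, a2, norm_sub_sq_real, norm_sub_sq_real (z.1 - w.1) (w'.1 - w.1), norm_smul,
        inner_smul_right, mul_pow, Real.norm_eq_abs, sq_abs]
      ring
    have hm' : 0 ≤ τ * (D - (1 - τ) * A) := by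
      simp only [proxObj, Prod.fst_add, Prod.snd_add, Prod.smul_fst, Prod.smul_snd,
        smul_eq_mul] at hm
      rw [e1] at hm
      simp only [hD, hA, proxObj]
      nlinarith
    have := nonneg_of_mul_nonneg_right hm' h0
    linarith
  by_contra! hlt
  have hlt' : D < A := by simp only [hD]; linarith
  have hApos : 0 < A := hD0.trans_lt hlt'
  have h1 := key ((A - D) / (2 * A)) (by apply div_pos <;> linarith)
    (by rw [div_lt_one (by linarith)]; linarith)
  have h2 : (1 - (A - D) / (2 * A)) * A = (A + D) / 2 := by field_simp; ring
  rw [h2] at h1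
  linarith

section prox

variable {N : ℝ} {W : SpaceTime d → ℝ} {prox : SpaceTime d → SpaceTime d}

/-- The quantitative monotonicity of the proximal map; it yields the Lipschitz bound on `prox` as well
as the upper and lower bounds on the Hessian of the Moreau envelope. -/
theorem prox_firmly_monotone (hN : 0 < N) (hW : ConvexOn ℝ univ W)
    (hprox : ∀ z w, proxObj N W z (prox z) ≤ proxObj N W z w) (z z' : SpaceTime d) :
    1 / 2 * (prox z' - prox z).2 ^ 2 + ‖(prox z' - prox z).1‖ ^ 2 ≤
      stInner (z' - z) (prox z' - prox z) := by
  have h1 := add_le_proxObj_of_isMin hW (hprox z) (prox z')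
  have h2 := add_le_proxObj_of_isMin hW (hprox z') (prox z)
  rw [norm_sub_rev (prox z).1] at h2
  have e : ∀ a b : EuclideanSpace ℝ (Fin d), ‖a - b‖ ^ 2 = ‖a‖ ^ 2 - 2 * inner ℝ a b + ‖b‖ ^ 2 :=
    norm_sub_sq_real
  rw [stInner_apply]
  simp only [Prod.fst_sub, Prod.snd_sub, inner_sub_left, inner_sub_right]
  simp only [proxObj] at h1 h2
  rw [e z.1, e z.1] at h1
  rw [e z'.1, e z'.1] at h2
  have h3 : 0 ≤ N * (4 * (inner ℝ z'.1 (prox z').1 - inner ℝ z.1 (prox z').1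
      - (inner ℝ z'.1 (prox z).1 - inner ℝ z.1 (prox z).1)
      + (z'.2 - z.2) * ((prox z').2 - (prox z).2))
      - 2 * ((prox z').2 - (prox z).2) ^ 2 - 4 * ‖(prox z').1 - (prox z).1‖ ^ 2) := by
    nlinarith
  have h4 := nonneg_of_mul_nonneg_right h3 hN
  linarith

theorem lipschitzWith_prox (hN : 0 < N) (hW : ConvexOn ℝ univ W)
    (hprox : ∀ z w, proxObj N W z (prox z) ≤ proxObj N W z w) : LipschitzWith 4 prox := by
  refine LipschitzWith.of_dist_le_mul fun z' z => ?_
  rw [dist_eq_norm, dist_eq_norm]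
  have h1 := prox_firmly_monotone hN hW hprox z z'
  have h2 := (le_abs_self _).trans (abs_stInner_le (z' - z) (prox z' - prox z))
  have h3 := sq_norm_le_stInner_self (prox z' - prox z)
  have h4 : ‖prox z' - prox z‖ ^ 2 ≤ 4 * (‖z' - z‖ * ‖prox z' - prox z‖) := by
    nlinarith [sq_nonneg ‖(prox z' - prox z).1‖]
  by_contra! hlt
  simp only [NNReal.coe_ofNat] at hlt
  have h5 : 0 < ‖prox z' - prox z‖ := lt_of_le_of_lt (by positivity) hlt
  nlinarith

theorem proxObj_sub_proxObj (N : ℝ) (W : SpaceTime d → ℝ) (z z' w : SpaceTime d) :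
    proxObj N W z' w - proxObj N W z w = stInner ((4 * N) • (z - w)) (z' - z) +
      2 * N * (‖(z' - z).1‖ ^ 2 + (z' - z).2 ^ 2) := by
  have e : ‖z'.1 - w.1‖ ^ 2 = ‖z.1 - w.1‖ ^ 2 + 2 * inner ℝ (z.1 - w.1) (z'.1 - z.1)
      + ‖z'.1 - z.1‖ ^ 2 := by
    rw [← norm_add_sq_real]; congr 2; abel
  rw [stInner_apply]
  simp only [proxObj, Prod.smul_fst, Prod.smul_snd, Prod.fst_sub, Prod.snd_sub, inner_smul_left,
    conj_trivial, smul_eq_mul]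
  rw [e]
  ring

/-- The Moreau envelope is differentiable everywhere, with gradient `4N (z - prox z)`: comparing the
minimization problems at `z` and `z'` bounds the increment on both sides up to `O(‖z' - z‖²)`. -/
theorem hasFDerivAt_moreau (hN : 0 < N) (hW : ConvexOn ℝ univ W)
    (hprox : ∀ z w, proxObj N W z (prox z) ≤ proxObj N W z w) (z : SpaceTime d) :
    HasFDerivAt (fun z => proxObj N W z (prox z)) (stInner ((4 * N) • (z - prox z))) z := by
  rw [hasFDerivAt_iff_isLittleO]
  have hO : (fun z' => proxObj N W z' (prox z') - proxObj N W z (prox z) -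
      stInner ((4 * N) • (z - prox z)) (z' - z)) =O[𝓝 z] fun z' => ‖z' - z‖ ^ 2 := by
    refine Asymptotics.IsBigO.of_bound (44 * N) (Eventually.of_forall fun z' => ?_)
    rw [Real.norm_eq_abs, Real.norm_of_nonneg (by positivity)]
    have h1 := hprox z' (prox z)
    have h2 := hprox z (prox z')
    have h3 := proxObj_sub_proxObj N W z z' (prox z)
    have h4 := proxObj_sub_proxObj N W z z' (prox z')
    have h5 := sq_norm_add_sq_le (z' - z)
    have hl := (lipschitzWith_prox hN hW hprox).dist_le_mul z' z
    rw [dist_eq_norm, dist_eq_norm, NNReal.coe_ofNat] at hl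
    have h6 := (abs_le.1 (abs_stInner_le (prox z' - prox z) (z' - z)))
    have h7 : stInner ((4 * N) • (z - prox z')) (z' - z) = stInner ((4 * N) • (z - prox z)) (z' - z)
        - 4 * N * stInner (prox z' - prox z) (z' - z) := by
      simp only [map_smul, map_sub, sub_apply, smul_apply,
        smul_eq_mul]
      ring
    have h8 : ‖prox z' - prox z‖ * ‖z' - z‖ ≤ 4 * ‖z' - z‖ ^ 2 := by
      rw [sq, ← mul_assoc]; exact mul_le_mul_of_nonneg_right hl (norm_nonneg _)
    have h9 : N * stInner (prox z' - prox z) (z' - z) ≤ N * (8 * ‖z' - z‖ ^ 2) :=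
      mul_le_mul_of_nonneg_left (by linarith) hN.le
    have h10 := mul_le_mul_of_nonneg_left h5 hN.le
    have h11 : 0 ≤ N * (‖(z' - z).1‖ ^ 2 + (z' - z).2 ^ 2) := by positivity
    have h12 : 0 ≤ N * ‖z' - z‖ ^ 2 := by positivity
    rw [abs_le]
    constructor <;> nlinarith
  exact hO.trans_isLittleO (Asymptotics.isLittleO_pow_sub_sub z one_lt_two)

end prox

/-! ### Determinants and Pucci's operator -/

open scoped MatrixOrder in
theorem Matrix.PosSemidef.trace_mul_nonneg {n : Type*} [Fintype n] {A X : Matrix n n ℝ}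
    (hA : A.PosSemidef) (hX : X.PosSemidef) : 0 ≤ (A * X).trace := by
  classical
  obtain ⟨B, rfl⟩ := CStarAlgebra.nonneg_iff_eq_star_mul_self.mp hX.nonneg
  rw [← mul_assoc, Matrix.trace_mul_comm, ← mul_assoc, Matrix.star_eq_conjTranspose]
  exact (hA.mul_mul_conjTranspose_same B).trace_nonneg

theorem Matrix.PosSemidef.det_le_trace_pow {n : Type*} [Fintype n] [DecidableEq n]
    {A : Matrix n n ℝ} (hA : A.PosSemidef) : A.det ≤ A.trace ^ Fintype.card n := by
  rw [hA.isHermitian.det_eq_prod_eigenvalues, hA.isHermitian.trace_eq_sum_eigenvalues]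
  rw [← Finset.card_univ, ← Finset.prod_const]
  refine Finset.prod_le_prod (fun i _ => hA.eigenvalues_nonneg i) fun i _ => ?_
  exact Finset.single_le_sum (f := fun i => ((hA.isHermitian.eigenvalues i : ℝ)))
    (fun j _ => hA.eigenvalues_nonneg j) (Finset.mem_univ i)

/-- On positive semidefinite matrices only the lower ellipticity constant matters. -/
theorem pucciMax_le_of_posSemidef {d : ℕ} {lam Lam : ℝ} (h : lam ≤ Lam)
    {X : Matrix (Fin d) (Fin d) ℝ} (hX : X.PosSemidef) :
    pucciMax lam Lam X ≤ -(lam * X.trace) := by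
  refine csSup_le ⟨_, lam • (1 : Matrix (Fin d) (Fin d) ℝ), ?_, ?_, ?_, rfl⟩ ?_
  · simp [Matrix.IsSymm]
  · simpa using Matrix.PosSemidef.zero
  · rw [← sub_smul]
    exact Matrix.PosSemidef.one.smul (sub_nonneg.2 h)
  · rintro _ ⟨A, -, hA, -, rfl⟩
    have := hA.trace_mul_nonneg hX
    simp [sub_mul] at this
    linarith


/-- The standard orthonormal basis of space-time. -/
noncomputable def stBasis (d : ℕ) : Module.Basis (Fin d ⊕ Unit) ℝ (SpaceTime d) :=
  (EuclideanSpace.basisFun (Fin d) ℝ).toBasis.prod (Module.Basis.singleton Unit ℝ)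

theorem stBasis_inl (i : Fin d) :
    stBasis d (Sum.inl i) = (EuclideanSpace.single i 1, 0) := by
  simp [stBasis, Module.Basis.prod_apply]

theorem stBasis_inr (i : Unit) : stBasis d (Sum.inr i) = (0, 1) := by
  simp [stBasis, Module.Basis.prod_apply]

theorem stBasis_repr (v : SpaceTime d) (k : Fin d ⊕ Unit) :
    (stBasis d).repr v k = stInner v (stBasis d k) := by
  rcases k with i | i
  · rw [stBasis_inl, stInner_apply]
    simp [stBasis, EuclideanSpace.inner_single_right]
  · rw [stBasis_inr, stInner_apply]
    simp [stBasis]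

theorem stInner_comm (a b : SpaceTime d) : stInner a b = stInner b a := by
  rw [stInner_apply, stInner_apply, real_inner_comm, mul_comm]

theorem sum_stBasis_repr_mul (v w : SpaceTime d) :
    ∑ k, (stBasis d).repr v k * (stBasis d).repr w k = stInner v w := by
  conv_rhs => rw [← (stBasis d).sum_repr w]
  rw [map_sum]
  refine Finset.sum_congr rfl fun k _ => ?_
  rw [map_smul, smul_eq_mul, mul_comm, stBasis_repr v]

theorem posSemidef_toMatrix_stBasis {T : SpaceTime d →ₗ[ℝ] SpaceTime d}
    (hsymm : ∀ a b, stInner (T a) b = stInner (T b) a) (hpos : ∀ a, 0 ≤ stInner (T a) a) :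
    (LinearMap.toMatrix (stBasis d) (stBasis d) T).PosSemidef := by
  refine Matrix.PosSemidef.of_dotProduct_mulVec_nonneg ?_ fun x => ?_
  · ext i j
    simp only [Matrix.conjTranspose_apply, LinearMap.toMatrix_apply, star_trivial, stBasis_repr]
    exact hsymm _ _
  · obtain ⟨v, rfl⟩ : ∃ v, ⇑((stBasis d).repr v) = x :=
      ⟨(stBasis d).equivFun.symm x, by
        rw [← Module.Basis.equivFun_apply, LinearEquiv.apply_symm_apply]⟩
    rw [LinearMap.toMatrix_mulVec_repr, star_trivial]
    have := sum_stBasis_repr_mul v (T v)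
    rw [dotProduct, this, stInner_comm]
    exact hpos v

theorem det_le_trace_pow_of_symmetric {T : SpaceTime d →ₗ[ℝ] SpaceTime d} {τ : ℝ}
    (hsymm : ∀ a b, stInner (T a) b = stInner (T b) a) (hpos : ∀ a, 0 ≤ stInner (T a) a)
    (hτ : (∑ i, (T (EuclideanSpace.single i 1, 0)).1 i) + (T (0, 1)).2 ≤ τ) :
    0 ≤ LinearMap.det T ∧ LinearMap.det T ≤ τ ^ (d + 1) := by
  have hM := posSemidef_toMatrix_stBasis hsymm hpos
  have h1 := hM.det_nonneg
  have h2 := hM.det_le_trace_pow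
  rw [LinearMap.det_toMatrix] at h1 h2
  have hc : Fintype.card (Fin d ⊕ Unit) = d + 1 := by simp
  have ht : (LinearMap.toMatrix (stBasis d) (stBasis d) T).trace =
      (∑ i, (T (EuclideanSpace.single i 1, 0)).1 i) + (T (0, 1)).2 := by
    simp [Matrix.trace, LinearMap.toMatrix_apply, stBasis_inl, stBasis_inr, stBasis_repr,
      stInner_apply, EuclideanSpace.inner_single_right]
  rw [hc] at h2
  exact ⟨h1, h2.trans (pow_le_pow_left₀ hM.trace_nonneg (ht.trans_le hτ) _)⟩

theorem det_shear (q : ℝ) (y : EuclideanSpace ℝ (Fin d))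
    {T : SpaceTime d →ₗ[ℝ] SpaceTime d} (hT : ∀ a, T a = (a.1, q * a.2 + inner ℝ y a.1)) :
    LinearMap.det T = q := by
  have : LinearMap.toMatrix (stBasis d) (stBasis d) T =
      Matrix.fromBlocks 1 0 (Matrix.of fun _ i => y i) (Matrix.of fun _ _ => q) := by
    ext i j
    rcases i with i | i <;> rcases j with j | j <;>
      simp [LinearMap.toMatrix_apply, stBasis_inl, stBasis_inr, stBasis_repr, stInner_apply, hT,
        Matrix.one_apply, EuclideanSpace.inner_single_right]
  rw [← LinearMap.det_toMatrix (stBasis d), this, Matrix.det_fromBlocks_zero₁₂]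
  simp

/-- The bound on the Jacobian of `slopeHeight`; `H` stands for the Hessian of the Moreau envelope,
`ε = 1 / (4N)`, and `L` for the derivative of `slopeHeight`.

With `S = H + ε⁻¹ e_t ⊗ e_t` one has `L = T ∘ diag(1, ε) ∘ S`, where `T` is a shear composed with the
multiplication by `q` in time. Hence `det L = q det S'` for `S' = diag(1, √ε) S diag(1, √ε)`, which
is positive semidefinite with trace at most `τ + 2`. -/
theorem abs_det_le_of_hessian_bounds {H : SpaceTime d →L[ℝ] SpaceTime d} {ε τ : ℝ} (hε : 0 < ε)
    (hsymm : ∀ a b, stInner (H a) b = stInner (H b) a)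
    (hlow : ∀ a, -a.2 ^ 2 ≤ ε * stInner (H a) a) (hup : ε * (H (0, 1)).2 ≤ 1)
    (hτ : ∑ i, (H (EuclideanSpace.single i 1, 0)).1 i ≤ τ) (q : ℝ)
    (y : EuclideanSpace ℝ (Fin d)) {L : SpaceTime d →L[ℝ] SpaceTime d}
    (hL : ∀ a, L a = ((H a).1, q * (a.2 + ε * (H a).2) + inner ℝ y (H a).1)) :
    |L.det| ≤ |q| * (τ + 2) ^ (d + 1) := by
  set r := √ε
  have hr : r * r = ε := Real.mul_self_sqrt hε.le
  set ρ : SpaceTime d →ₗ[ℝ] SpaceTime d :=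
    (LinearMap.id : EuclideanSpace ℝ (Fin d) →ₗ[ℝ] EuclideanSpace ℝ (Fin d)).prodMap
      (r • LinearMap.id) with hρ
  have hρa : ∀ a, ρ a = (a.1, r * a.2) := fun a => by simp [hρ]
  set S : SpaceTime d →ₗ[ℝ] SpaceTime d := (H : SpaceTime d →ₗ[ℝ] SpaceTime d) +
    (0 : EuclideanSpace ℝ (Fin d) →ₗ[ℝ] EuclideanSpace ℝ (Fin d)).prodMap
      (ε⁻¹ • LinearMap.id) with hS
  have hSa : ∀ a, S a = ((H a).1, (H a).2 + ε⁻¹ * a.2) := fun a => by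
    ext <;> simp [hS]
  set T : SpaceTime d →ₗ[ℝ] SpaceTime d :=
    (LinearMap.fst ℝ _ _).prod (q • LinearMap.snd ℝ _ _ +
      (innerSL ℝ y : EuclideanSpace ℝ (Fin d) →ₗ[ℝ] ℝ) ∘ₗ LinearMap.fst ℝ _ _) with hT
  have hTa : ∀ a, T a = (a.1, q * a.2 + inner ℝ y a.1) := fun a => by simp [hT]
  have hcomp : (L : SpaceTime d →ₗ[ℝ] SpaceTime d) = T ∘ₗ ρ ∘ₗ ρ ∘ₗ S := by
    refine LinearMap.ext fun a => ?_
    simp only [ContinuousLinearMap.coe_coe, LinearMap.comp_apply, hTa, hρa, hSa, hL]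
    congr 1
    rw [← mul_assoc r r, hr]
    field_simp
    ring
  have hdet : L.det = q * LinearMap.det (ρ ∘ₗ S ∘ₗ ρ) := by
    rw [ContinuousLinearMap.det, hcomp]
    simp only [LinearMap.det_comp, det_shear q y hTa]
    ring
  have hρρ : ∀ a b : SpaceTime d, stInner (ρ a) b = stInner a (ρ b) := fun a b => by
    rw [stInner_apply, stInner_apply, hρa, hρa]; ring
  have hSs : ∀ a b : SpaceTime d, stInner (S a) b = stInner (H a) b + ε⁻¹ * (a.2 * b.2) :=
    fun a b => by
      rw [stInner_apply, stInner_apply, hSa]; ring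
  have htr : (∑ i, ((ρ ∘ₗ S ∘ₗ ρ) (EuclideanSpace.single i 1, 0)).1 i) +
      ((ρ ∘ₗ S ∘ₗ ρ) (0, 1)).2 ≤ τ + 2 := by
    have e1 : ((ρ ∘ₗ S ∘ₗ ρ) (0, 1)).2 = ε * (H (0, 1)).2 + 1 := by
      simp only [LinearMap.comp_apply, hρa, hSa]
      have : H (0, r * 1) = r • H (0, 1) := by rw [← map_smul]; simp
      rw [this]
      simp only [Prod.smul_snd, smul_eq_mul, mul_one]
      calc r * (r * (H (0, 1)).2 + ε⁻¹ * r)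
          = (r * r) * (H (0, 1)).2 + ε⁻¹ * (r * r) := by ring
        _ = _ := by rw [hr, inv_mul_cancel₀ hε.ne']
    rw [e1]
    simp only [LinearMap.comp_apply, hρa, hSa, mul_zero]
    linarith
  have hbd := det_le_trace_pow_of_symmetric (T := ρ ∘ₗ S ∘ₗ ρ) (fun a b => by
      simp only [LinearMap.comp_apply, hρρ, hSs]
      rw [hsymm, mul_comm (ρ a).2]) (fun a => by
      simp only [LinearMap.comp_apply, hρρ, hSs]
      have h1 := hlow (ρ a)
      have h2 : 0 ≤ ε * (stInner (H (ρ a)) (ρ a) + ε⁻¹ * ((ρ a).2 * (ρ a).2)) := by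
        rw [mul_add, ← mul_assoc, mul_inv_cancel₀ hε.ne']
        linarith
      exact nonneg_of_mul_nonneg_right h2 hε) htr
  rw [hdet, abs_mul, abs_of_nonneg hbd.1]
  exact mul_le_mul_of_nonneg_left hbd.2 (abs_nonneg q)

/-! ### Subjets from smooth functions touching from below -/

/-- The matrix of the space-space block of a linear map of space-time. -/
noncomputable def spatialBlock (H : SpaceTime d →L[ℝ] SpaceTime d) : Matrix (Fin d) (Fin d) ℝ :=
  Matrix.of fun i j => (H (EuclideanSpace.single j 1, 0)).1 i

theorem toEuclideanCLM_spatialBlock (H : SpaceTime d →L[ℝ] SpaceTime d)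
    (x : EuclideanSpace ℝ (Fin d)) :
    Matrix.toEuclideanCLM (𝕜 := ℝ) (spatialBlock H) x = (H (x, 0)).1 := by
  have hx : (x, (0 : ℝ)) = ∑ j, x j • ((EuclideanSpace.single j 1, 0) : SpaceTime d) := by
    refine Prod.ext ?_ ?_
    · ext i
      simp [Prod.fst_sum, Pi.single_apply]
    · simp [Prod.snd_sum]
  have hH : H (x, 0) = ∑ j, x j • H (EuclideanSpace.single j 1, 0) := by
    simp_rw [hx, map_sum, map_smul]
  rw [hH]
  ext i
  rw [Matrix.ofLp_toEuclideanCLM]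
  simp [Matrix.mulVec, dotProduct, spatialBlock, Prod.fst_sum, mul_comm]

theorem isSymm_spatialBlock {H : SpaceTime d →L[ℝ] SpaceTime d}
    (hsymm : ∀ a b, stInner (H a) b = stInner (H b) a) : (spatialBlock H).IsSymm := by
  ext i j
  have := hsymm (EuclideanSpace.single i 1, 0) (EuclideanSpace.single j 1, 0)
  simpa [stInner_apply, spatialBlock, EuclideanSpace.inner_single_right] using this

theorem posSemidef_spatialBlock {H : SpaceTime d →L[ℝ] SpaceTime d}
    (hsymm : ∀ a b, stInner (H a) b = stInner (H b) a)
    (hpos : ∀ x : EuclideanSpace ℝ (Fin d), 0 ≤ stInner (H (x, 0)) (x, 0)) :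
    (spatialBlock H).PosSemidef := by
  refine Matrix.PosSemidef.of_dotProduct_mulVec_nonneg ?_ fun x => ?_
  · rw [Matrix.IsHermitian, Matrix.conjTranspose_eq_transpose_of_trivial]
    exact isSymm_spatialBlock hsymm
  · have h := hpos (WithLp.toLp 2 x)
    rw [stInner_apply, ← toEuclideanCLM_spatialBlock] at h
    simpa [dotProduct, PiLp.inner_apply, Matrix.ofLp_toEuclideanCLM] using h

/-- If `g`, translated so that `z` goes to `w`, touches `u` from below at `w`, and the gradient `G` of
`g` is differentiable at `z`, then the expansion of `g` is a parabolic subjet of `u` at `w`. The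
derivatives `∂_t D_x g` and `∂_t² g` do not appear, since `|δt| |δx|` and `δt²` are
`o(|δt| + |δx|²)`. -/
theorem isParabolicSubjet_of_touching {Q : Set (SpaceTime d)} {u g : SpaceTime d → ℝ}
    {G : SpaceTime d → SpaceTime d} {H : SpaceTime d →L[ℝ] SpaceTime d} {w z : SpaceTime d}
    (hg : ∀ y, HasFDerivAt g (stInner (G y)) y) (hG : HasFDerivAt G H z)
    (htouch : ∀ᶠ y in 𝓝[Q] w, u w + (g (z + (y - w)) - g z) ≤ u y) :
    (∀ a b, stInner (H a) b = stInner (H b) a) ∧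
      IsParabolicSubjet Q u w (G z).2 (G z).1 (spatialBlock H) := by
  have hG' : HasFDerivAt (fun y => stInner (G y)) (stInner.comp H) z :=
    stInner.hasFDerivAt.comp z hG
  have hsymm : ∀ a b, stInner (H a) b = stInner (H b) a :=
    fun a b => second_derivative_symmetric hg hG' a b
  refine ⟨hsymm, isSymm_spatialBlock hsymm, fun ε hε => ?_⟩
  have htay := eventually_abs_sub_taylor_two_le hg hG' (half_pos hε)
  have hcont : Tendsto (fun y => z + (y - w)) (𝓝[Q] w) (𝓝 z) := by
    have : ContinuousAt (fun y => z + (y - w)) w := by fun_prop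
    have h := this.tendsto
    simp only [sub_self, add_zero] at h
    exact h.mono_left nhdsWithin_le_nhds
  have hsmall : ∀ᶠ y in 𝓝[Q] w, ‖y - w‖ ≤ 1 ∧ 4 * ‖H‖ * ‖y - w‖ ≤ ε := by
    have hc : Tendsto (fun y => ‖y - w‖) (𝓝[Q] w) (𝓝 0) := by
      have : ContinuousAt (fun y => ‖y - w‖) w := by fun_prop
      have h := this.tendsto
      simp only [sub_self, norm_zero] at h
      exact h.mono_left nhdsWithin_le_nhds
    have h2 := hc.const_mul (4 * ‖H‖)
    rw [mul_zero] at h2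
    exact ((hc.eventually_lt_const one_pos).and (h2.eventually_lt_const hε)).mono
      fun y hy => ⟨hy.1.le, hy.2.le⟩
  filter_upwards [htouch, hcont.eventually htay, hsmall] with y h1 h2 h3
  simp only [add_sub_cancel_left] at h2
  set δ := y - w with hδ
  have e1 : y.1 - w.1 = δ.1 := rfl
  have e2 : y.2 - w.2 = δ.2 := rfl
  rw [e1, e2, toEuclideanCLM_spatialBlock]
  have hsplit : (stInner.comp H) δ δ = inner ℝ δ.1 (H (δ.1, 0)).1 +
      (stInner (H (0, δ.2)) δ + stInner (H (δ.1, 0)) (0, δ.2)) := by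
    have hd : δ = (δ.1, 0) + (0, δ.2) := by ext <;> simp
    have hH : H δ = H (δ.1, 0) + H (0, δ.2) := by rw [← map_add, ← hd]
    rw [ContinuousLinearMap.comp_apply, hH, stInner_apply, stInner_apply, stInner_apply,
      real_inner_comm δ.1]
    simp only [Prod.fst_add, Prod.snd_add, inner_add_right, inner_zero_right, zero_add,
      real_inner_comm δ.1 (H (0, δ.2)).1]
    ring
  have hn1 : ‖((δ.1, 0) : SpaceTime d)‖ ≤ ‖δ‖ := by
    simp [Prod.norm_def]
  have hn2 : ‖((0, δ.2) : SpaceTime d)‖ = |δ.2| := by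
    simp [Prod.norm_def]
  have hb1 : |stInner (H (0, δ.2)) δ| ≤ 2 * (‖H‖ * |δ.2| * ‖δ‖) := by
    refine (abs_stInner_le _ _).trans ?_
    have := H.le_opNorm (0, δ.2)
    rw [hn2] at this
    gcongr
  have hb2 : |stInner (H (δ.1, 0)) (0, δ.2)| ≤ 2 * (‖H‖ * |δ.2| * ‖δ‖) := by
    refine (abs_stInner_le _ _).trans ?_
    rw [hn2]
    have := (H.le_opNorm (δ.1, 0)).trans (mul_le_mul_of_nonneg_left hn1 (norm_nonneg H))
    nlinarith [mul_le_mul_of_nonneg_right this (abs_nonneg δ.2)]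
  have hb3 : 4 * (‖H‖ * |δ.2| * ‖δ‖) ≤ ε * |δ.2| := by
    nlinarith [mul_le_mul_of_nonneg_right h3.2 (abs_nonneg δ.2)]
  have hn3 := sq_norm_le_stInner_self δ
  have hn4 : δ.2 ^ 2 ≤ |δ.2| := by
    have : |δ.2| ≤ 1 := (norm_snd_le δ).trans h3.1
    rw [← sq_abs]
    nlinarith [abs_nonneg δ.2]
  have h2' := (abs_le.1 h2).1
  rw [hsplit] at h2'
  have hlin : stInner (G z) δ = inner ℝ (G z).1 δ.1 + (G z).2 * δ.2 := stInner_apply _ _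
  rw [hlin] at h2'
  have hb1' := (abs_le.1 hb1).1
  have hb2' := (abs_le.1 hb2).1
  have hn5 := mul_le_mul_of_nonneg_left (hn3.trans (add_le_add_right hn4 _)) (half_pos hε).le
  linarith [mul_nonneg hε.le (sq_nonneg ‖δ.1‖)]

/-! ### Null sets under locally Lipschitz maps -/

theorem LocallyLipschitz.addHaar_image_eq_zero {E : Type*} [NormedAddCommGroup E] [NormedSpace ℝ E]
    [FiniteDimensional ℝ E] [MeasurableSpace E] [BorelSpace E] (μ : Measure E)
    [μ.IsAddHaarMeasure] {f : E → E} (hf : LocallyLipschitz f) {s : Set E} (hs : μ s = 0) :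
    μ (f '' s) = 0 := by
  have hμ : μ ≪ Measure.hausdorffMeasure (Module.finrank ℝ E) :=
    Measure.absolutelyContinuous_isAddHaarMeasure _ _
  have hμ' : Measure.hausdorffMeasure (Module.finrank ℝ E) ≪ μ :=
    Measure.absolutelyContinuous_isAddHaarMeasure _ _
  choose K t ht hK using hf
  obtain ⟨c, hc, hcu⟩ := TopologicalSpace.countable_cover_nhds ht
  have hcover : f '' s ⊆ ⋃ x ∈ c, f '' (s ∩ t x) := by
    rintro _ ⟨y, hy, rfl⟩
    have : y ∈ ⋃ x ∈ c, t x := hcu ▸ mem_univ y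
    simp only [mem_iUnion] at this ⊢
    obtain ⟨x, hx, hyx⟩ := this
    exact ⟨x, hx, y, ⟨hy, hyx⟩, rfl⟩
  refine measure_mono_null hcover ((measure_biUnion_null_iff hc).2 fun x _ => hμ ?_)
  have h1 := ((hK x).mono (inter_subset_right (s := s))).hausdorffMeasure_image_le
    (Module.finrank ℝ E).cast_nonneg
  rw [hμ' (measure_mono_null inter_subset_left hs), mul_zero] at h1
  exact le_antisymm h1 bot_le

theorem addHaar_image_comp_prodMk_eq_zero {E : Type*} [NormedAddCommGroup E] [NormedSpace ℝ E]
    [FiniteDimensional ℝ E] [MeasurableSpace E] [BorelSpace E] (μ : Measure E)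
    [μ.IsAddHaarMeasure] {f : E → E} {C : ℝ≥0} (hf : LipschitzWith C f) {Ψ : E × E → E}
    (hΨ : ContDiff ℝ 1 Ψ) {s : Set E} (hs : μ s = 0) :
    μ ((fun x => Ψ (x, f x)) '' s) = 0 :=
  LocallyLipschitz.addHaar_image_eq_zero μ
    (hΨ.locallyLipschitz.comp (LocallyLipschitz.id.prodMk hf.locallyLipschitz)) hs


/-! ### The estimate for a fixed penalization -/

/-- The convex envelope of `v` over `K`, restricted to affine functions of slope at most `R` so that it
is finite on all of space-time, even if `K` is small. -/
theorem exists_convex_envelope {K : Set (SpaceTime d)} (hK : IsCompact K) (hne : K.Nonempty)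
    {v : SpaceTime d → ℝ} (hv : ContinuousOn v K) {R : ℝ} (hR : 0 ≤ R) :
    ∃ W : SpaceTime d → ℝ, ConvexOn ℝ univ W ∧ Continuous W ∧ (∃ c, ∀ x, -c * (1 + ‖x‖) ≤ W x) ∧
      (∀ x ∈ K, W x ≤ v x) ∧
      ∀ (a : SpaceTime d) (b : ℝ), ‖a‖ ≤ R → (∀ x ∈ K, stInner a x + b ≤ v x) →
        ∀ x, stInner a x + b ≤ W x := by
  obtain ⟨x₀, hx₀⟩ := hne
  obtain ⟨m, -, hm⟩ := hK.exists_isMinOn ⟨x₀, hx₀⟩ hv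
  let ι := {ab : SpaceTime d × ℝ // ‖ab.1‖ ≤ R ∧ ∀ x ∈ K, stInner ab.1 x + ab.2 ≤ v x}
  let i₀ : ι := ⟨(0, v m), by simpa using hR, fun x hx => by simpa using hm hx⟩
  have : Nonempty ι := ⟨i₀⟩
  have hbdd : ∀ x, BddAbove (range fun i : ι => stInner i.1.1 x + i.1.2) := by
    intro x
    refine ⟨v x₀ + 2 * (R * ‖x - x₀‖), ?_⟩
    rintro _ ⟨⟨⟨a, b⟩, ha, hab⟩, rfl⟩
    have h1 := hab x₀ hx₀
    have h2 := (abs_le.1 (abs_stInner_le a (x - x₀))).2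
    have h3 := mul_le_mul_of_nonneg_right ha (norm_nonneg (x - x₀))
    rw [map_sub] at h2
    simp only at *
    linarith
  have hconv : ConvexOn ℝ univ fun x => ⨆ i : ι, (stInner i.1.1 x + i.1.2) := by
    refine ⟨convex_univ, fun x _ y _ s t hs ht hst => ciSup_le fun i => ?_⟩
    have h1 := mul_le_mul_of_nonneg_left (le_ciSup (hbdd x) i) hs
    have h2 := mul_le_mul_of_nonneg_left (le_ciSup (hbdd y) i) ht
    simp only [smul_eq_mul, map_add, map_smul]
    have h3 : i.1.2 = s * i.1.2 + t * i.1.2 := by rw [← add_mul, hst, one_mul]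
    linarith
  refine ⟨fun x => ⨆ i : ι, (stInner i.1.1 x + i.1.2), hconv, ?_, ⟨|v m|, fun x => ?_⟩,
    fun x hx => ciSup_le fun i => i.2.2 x hx, fun a b ha hab x => ?_⟩
  · exact continuousOn_univ.1 (hconv.continuousOn isOpen_univ)
  · have h1 := le_ciSup (hbdd x) i₀
    simp only [i₀, map_zero, zero_apply, zero_add] at h1
    have h2 := neg_abs_le (v m)
    nlinarith [abs_nonneg (v m), norm_nonneg x]
  · exact le_ciSup (hbdd x) (⟨(a, b), ha, hab⟩ : ι)

section prox

variable {N : ℝ} {W : SpaceTime d → ℝ} {prox : SpaceTime d → SpaceTime d}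

theorem prox_eq_of_isMin (hN : 0 < N) (hW : ConvexOn ℝ univ W)
    (hprox : ∀ z w, proxObj N W z (prox z) ≤ proxObj N W z w) {z w : SpaceTime d}
    (hw : ∀ w', proxObj N W z w ≤ proxObj N W z w') : prox z = w := by
  have h1 := add_le_proxObj_of_isMin hW hw (prox z)
  have h2 := hprox z w
  have h3 := sq_norm_le_stInner_self (prox z - w)
  have h4 : N * ((prox z).2 - w.2) ^ 2 + 2 * N * ‖(prox z).1 - w.1‖ ^ 2 ≤ 0 := by linarith
  have h5 : N * ‖prox z - w‖ ^ 2 ≤ 0 := by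
    simp only [Prod.fst_sub, Prod.snd_sub] at h3
    nlinarith [mul_le_mul_of_nonneg_left h3 hN.le,
      mul_nonneg hN.le (sq_nonneg ‖(prox z).1 - w.1‖)]
  have h6 : ‖prox z - w‖ ^ 2 ≤ 0 := nonpos_of_mul_nonpos_right h5 hN
  have h7 : ‖prox z - w‖ = 0 := by nlinarith [norm_nonneg (prox z - w)]
  exact sub_eq_zero.1 (norm_eq_zero.1 h7)

/-- The infinitesimal form of `prox_firmly_monotone`. -/
theorem hasFDerivAt_prox_bound (hN : 0 < N) (hW : ConvexOn ℝ univ W)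
    (hprox : ∀ z w, proxObj N W z (prox z) ≤ proxObj N W z w) {z : SpaceTime d}
    {B : SpaceTime d →L[ℝ] SpaceTime d} (hB : HasFDerivAt prox B z) (a : SpaceTime d) :
    1 / 2 * (B a).2 ^ 2 + ‖(B a).1‖ ^ 2 ≤ stInner a (B a) := by
  have hline : HasDerivAt (fun t : ℝ => prox (z + t • a)) (B a) 0 := by
    have h1 : HasDerivAt (fun t : ℝ => z + t • a) a 0 := by
      simpa using! ((hasDerivAt_id (0 : ℝ)).smul_const a).const_add z
    have h2 : HasFDerivAt prox B (z + (0 : ℝ) • a) := by simpa using hB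
    exact h2.comp_hasDerivAt 0 h1
  have hlim := hline.tendsto_slope_zero
  simp only [zero_add, zero_smul, add_zero] at hlim
  have hc : IsClosed {v : SpaceTime d | 1 / 2 * v.2 ^ 2 + ‖v.1‖ ^ 2 ≤ stInner a v} :=
    isClosed_le (by fun_prop) (by fun_prop)
  refine hc.mem_of_tendsto hlim ?_
  filter_upwards [self_mem_nhdsWithin] with t ht
  have ht0 : t ≠ 0 := ht
  have h := prox_firmly_monotone hN hW hprox z (z + t • a)
  rw [add_sub_cancel_left] at h
  set Δ := prox (z + t • a) - prox z
  have hΔ : Δ = t • (t⁻¹ • Δ) := by rw [smul_smul, mul_inv_cancel₀ ht0, one_smul]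
  rw [hΔ] at h
  set v := t⁻¹ • Δ
  simp only [Prod.smul_fst, Prod.smul_snd, norm_smul, map_smul, smul_apply, smul_eq_mul, mul_pow,
    Real.norm_eq_abs, sq_abs] at h
  have ht2 : 0 < t ^ 2 := by positivity
  have h' : 0 ≤ t ^ 2 * (stInner a v - (1 / 2 * v.2 ^ 2 + ‖v.1‖ ^ 2)) := by linarith
  have := nonneg_of_mul_nonneg_right h' ht2
  change 1 / 2 * v.2 ^ 2 + ‖v.1‖ ^ 2 ≤ stInner a v
  linarith

end prox

/-- The map taking `z` to `(p, h)`, where `(p, q) = G z` is the gradient of `g` at `z` and `h` is the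
height `u(w) - p · x_w + q² / (4N)` of the contact at `w = z - (p, q) / (4N)`, expressed through `z`
and `g(z) = u(w) + (|p|² + q²) / (8N)`. -/
noncomputable def slopeHeight (N : ℝ) (g : SpaceTime d → ℝ) (G : SpaceTime d → SpaceTime d)
    (z : SpaceTime d) : SpaceTime d :=
  ((G z).1, g z - inner ℝ (G z).1 z.1 + 1 / (8 * N) * (‖(G z).1‖ ^ 2 + (G z).2 ^ 2))

/-- `slopeHeight` is a `C¹` function of `z` and `prox z`, so it maps null sets to null sets. -/
theorem volume_image_slopeHeight_eq_zero (N : ℝ) {g : SpaceTime d → ℝ}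
    {prox : SpaceTime d → SpaceTime d} {C : ℝ≥0} (hprox : LipschitzWith C prox)
    (hg : ∀ z, HasFDerivAt g (stInner ((4 * N) • (z - prox z))) z) {s : Set (SpaceTime d)}
    (hs : volume s = 0) :
    volume (slopeHeight N g (fun z => (4 * N) • (z - prox z)) '' s) = 0 := by
  have h1 : ContDiff ℝ 1 g := by
    refine contDiff_one_iff_fderiv.2 ⟨fun z => (hg z).differentiableAt, ?_⟩
    rw [show fderiv ℝ g = fun z => stInner ((4 * N) • (z - prox z)) from
      funext fun z => (hg z).fderiv]
    exact stInner.continuous.comp ((continuous_id.sub hprox.continuous).const_smul (4 * N))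
  have h2 : ContDiff ℝ 1 fun x : SpaceTime d × SpaceTime d => (4 * N) • (x.1 - x.2) :=
    (contDiff_fst.sub contDiff_snd).const_smul (4 * N)
  have h3 : ContDiff ℝ 1 fun x : SpaceTime d × SpaceTime d =>
      slopeHeight N g (fun _ => (4 * N) • (x.1 - x.2)) x.1 :=
    h2.fst.prodMk (((h1.comp contDiff_fst).sub (h2.fst.inner ℝ contDiff_fst.fst)).add
      (contDiff_const.mul ((h2.fst.norm_sq ℝ).add (h2.snd.pow 2))))
  exact addHaar_image_comp_prodMk_eq_zero volume hprox h3 hs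

theorem exists_hasFDerivAt_slopeHeight (N : ℝ) {g : SpaceTime d → ℝ}
    {G : SpaceTime d → SpaceTime d} {z : SpaceTime d} (hg : HasFDerivAt g (stInner (G z)) z)
    {H : SpaceTime d →L[ℝ] SpaceTime d} (hG : HasFDerivAt G H z) :
    ∃ L : SpaceTime d →L[ℝ] SpaceTime d, HasFDerivAt (slopeHeight N g G) L z ∧
      ∀ a, L a = ((H a).1, (G z).2 * (a.2 + 1 / (4 * N) * (H a).2) +
        inner ℝ ((1 / (4 * N)) • (G z).1 - z.1) (H a).1) := by
  have hx : HasFDerivAt (fun y : SpaceTime d => y.1)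
    (ContinuousLinearMap.fst ℝ (EuclideanSpace ℝ (Fin d)) ℝ) z := hasFDerivAt_fst
  have hG1 : HasFDerivAt (fun y => (G y).1)
    ((ContinuousLinearMap.fst ℝ (EuclideanSpace ℝ (Fin d)) ℝ).comp H) z :=
    hasFDerivAt_fst.comp z hG
  have hG2 : HasFDerivAt (fun y => (G y).2)
    ((ContinuousLinearMap.snd ℝ (EuclideanSpace ℝ (Fin d)) ℝ).comp H) z :=
    hasFDerivAt_snd.comp z hG
  refine ⟨_, hG1.prodMk ((hg.sub (hG1.inner ℝ hx)).add
    ((hG1.norm_sq.add (hG2.pow 2)).const_mul (1 / (8 * N)))), fun a => Prod.ext rfl ?_⟩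
  simp only [ContinuousLinearMap.prod_apply, add_apply, sub_apply, smul_apply, stInner_apply,
    ContinuousLinearMap.comp_apply, ContinuousLinearMap.coe_fst', ContinuousLinearMap.coe_snd',
    fderivInnerCLM_apply, innerSL_apply_apply, smul_eq_mul, inner_sub_left, inner_smul_left,
    conj_trivial, Nat.add_one_sub_one, pow_one,
    real_inner_comm z.1 (H a).1, two_smul]
  simp
  ring

/-- The estimate at level `N`. The pairs considered come from contact points `w` of `u` on `K`, with a
lower test function whose gradient is `(p, q)` and whose concavity in time is at most `2N`; the set
`U` has to contain the points `w + (p, q) / (4N)` rather than the `w`. -/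
theorem volume_contact_le {lam Lam : ℝ} (hlam : 0 < lam) (hle : lam ≤ Lam)
    {Q K : Set (SpaceTime d)} (hKQ : K ⊆ Q) (hK : IsCompact K) {u : SpaceTime d → ℝ}
    (hu : ContinuousOn u Q) (hvisc : IsViscositySupersolution Q (pucciMax lam Lam) (-1) u)
    {N : ℝ} (hN : 0 < N) (R : ℝ) {U : Set (SpaceTime d)} (hU : IsOpen U) :
    volume {ph : SpaceTime d | ∃ w ∈ interior K, ∃ q : ℝ, q ≤ 0 ∧ ‖ph.1‖ ≤ R ∧ |q| ≤ R ∧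
      (∀ z ∈ K, u w + inner ℝ ph.1 (z.1 - w.1) + q * (z.2 - w.2) - N * (z.2 - w.2) ^ 2 ≤ u z) ∧
      ph.2 = u w - inner ℝ ph.1 w.1 + q ^ 2 / (4 * N) ∧ w + (1 / (4 * N)) • (ph.1, q) ∈ U} ≤
    ENNReal.ofReal ((1 / lam + 2) ^ (d + 1)) * volume U := by
  rcases K.eq_empty_or_nonempty with rfl | hne
  · simp
  rcases lt_or_ge R 0 with hR0 | hR0
  · refine le_of_eq_of_le (measure_mono_null (fun ph hph => ?_) measure_empty) bot_le
    obtain ⟨w, -, q, -, h, -⟩ := hph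
    exact absurd ((norm_nonneg _).trans h) (not_le.2 hR0)
  obtain ⟨RK, hRK⟩ := hK.isBounded.exists_norm_le
  have hRK0 : 0 ≤ RK := (norm_nonneg _).trans (hRK _ hne.some_mem)
  obtain ⟨W, hW, hWc, ⟨c, hWlow⟩, hWle, hWge⟩ := exists_convex_envelope hK hne
    (v := fun z => u z + N * z.2 ^ 2) ((hu.mono hKQ).add (by fun_prop))
    (R := R + 2 * N * RK) (by positivity)
  obtain ⟨prox, hprox⟩ := exists_prox hN hWc hWlow
  set g : SpaceTime d → ℝ := fun z => proxObj N W z (prox z) with hgdef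
  set G : SpaceTime d → SpaceTime d := fun z => (4 * N) • (z - prox z) with hGdef
  have hg : ∀ z, HasFDerivAt g (stInner (G z)) z := hasFDerivAt_moreau hN hW hprox
  set Φ : SpaceTime d → SpaceTime d := slopeHeight N g G with hΦdef
  -- The test function plus `N t²` dominates an affine function touching `W` at `w`.
  have hcontact : ∀ w ∈ K, ∀ (p : EuclideanSpace ℝ (Fin d)) (q : ℝ), ‖p‖ ≤ R → |q| ≤ R →
      (∀ z ∈ K, u w + inner ℝ p (z.1 - w.1) + q * (z.2 - w.2) - N * (z.2 - w.2) ^ 2 ≤ u z) →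
      prox (w + (1 / (4 * N)) • (p, q)) = w ∧ W w = u w + N * w.2 ^ 2 := by
    intro w hw p q hp hq hpq
    set a : SpaceTime d := (p, q + 2 * N * w.2) with ha
    have haR : ‖a‖ ≤ R + 2 * N * RK := by
      refine max_le (hp.trans (by simp only [le_add_iff_nonneg_right]; positivity)) ?_
      have h1 : |w.2| ≤ RK := (norm_snd_le w).trans (hRK w hw)
      calc ‖q + 2 * N * w.2‖ ≤ |q| + |2 * N * w.2| := abs_add_le _ _
        _ ≤ R + 2 * N * RK := by
          rw [abs_mul, abs_of_pos (by positivity : (0 : ℝ) < 2 * N)]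
          gcongr
    have hge := hWge a (u w + N * w.2 ^ 2 - stInner a w) haR (fun z hz => by
      have h1 := hpq z hz
      simp only [stInner_apply, ha]
      rw [inner_sub_right] at h1
      nlinarith)
    have hWw : W w = u w + N * w.2 ^ 2 :=
      le_antisymm (hWle w hw) (by have := hge w; linarith)
    refine ⟨prox_eq_of_isMin hN hW hprox fun w' => ?_, hWw⟩
    have h1 := hge w'
    rw [← hWw] at h1
    have e1 : w.1 + (1 / (4 * N)) • p - w'.1 = (1 / (4 * N)) • p - (w'.1 - w.1) := by abel
    have e2 : w.1 + (1 / (4 * N)) • p - w.1 = (1 / (4 * N)) • p := by abel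
    simp only [proxObj, Prod.fst_add, Prod.snd_add, Prod.smul_mk, smul_eq_mul]
    rw [e1, e2, norm_sub_sq_real, inner_smul_left]
    simp only [stInner_apply, ha, conj_trivial] at h1 ⊢
    rw [inner_sub_right]
    have h2 : 0 ≤ N * ‖w'.1 - w.1‖ ^ 2 := by positivity
    have h3 : 0 ≤ N * (w'.2 - w.2) ^ 2 := by positivity
    have e3 : ∀ s : ℝ, 2 * N * (2 * (1 / (4 * N) * s)) = s := fun s => by field_simp; ring
    have e4 := e3 (inner ℝ p w'.1 - inner ℝ p w.1)
    have e5 := e3 (q * (w'.2 - w.2))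
    nlinarith
  have hΦcontact : ∀ w ∈ K, ∀ (p : EuclideanSpace ℝ (Fin d)) (q : ℝ), ‖p‖ ≤ R → |q| ≤ R →
      (∀ z ∈ K, u w + inner ℝ p (z.1 - w.1) + q * (z.2 - w.2) - N * (z.2 - w.2) ^ 2 ≤ u z) →
      G (w + (1 / (4 * N)) • (p, q)) = (p, q) ∧ Φ (w + (1 / (4 * N)) • (p, q)) =
        (p, u w - inner ℝ p w.1 + q ^ 2 / (4 * N)) := by
    intro w hw p q hp hq hpq
    obtain ⟨h1, h2⟩ := hcontact w hw p q hp hq hpq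
    have hG1 : G (w + (1 / (4 * N)) • (p, q)) = (p, q) := by
      simp only [hGdef, h1, add_sub_cancel_left, smul_smul]
      rw [mul_one_div_cancel (by positivity), one_smul]
    refine ⟨hG1, ?_⟩
    simp only [hΦdef, slopeHeight, hG1, hgdef, h1]
    refine Prod.ext rfl ?_
    simp only [proxObj, h2, Prod.fst_add, Prod.snd_add, Prod.smul_mk, smul_eq_mul,
      add_sub_cancel_left, inner_add_right, inner_smul_right, norm_smul, mul_pow,
      real_inner_self_eq_norm_sq, Real.norm_eq_abs, sq_abs]
    field_simp
    ring
  -- The supersolution inequality bounds the Jacobian where `prox` is differentiable.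
  have hjac : ∀ w ∈ interior K, ∀ (p : EuclideanSpace ℝ (Fin d)) (q : ℝ), q ≤ 0 → ‖p‖ ≤ R →
      |q| ≤ R →
      (∀ z ∈ K, u w + inner ℝ p (z.1 - w.1) + q * (z.2 - w.2) - N * (z.2 - w.2) ^ 2 ≤ u z) →
      DifferentiableAt ℝ prox (w + (1 / (4 * N)) • (p, q)) →
      DifferentiableAt ℝ Φ (w + (1 / (4 * N)) • (p, q)) ∧
      |(fderiv ℝ Φ (w + (1 / (4 * N)) • (p, q))).det| ≤ (1 / lam + 2) ^ (d + 1) := by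
    intro w hw p q hq0 hp hq hpq hdiff
    have hwK := interior_subset hw
    obtain ⟨h1, h2⟩ := hcontact w hwK p q hp hq hpq
    obtain ⟨hG1, -⟩ := hΦcontact w hwK p q hp hq hpq
    set z := w + (1 / (4 * N)) • (p, q) with hz
    set B := fderiv ℝ prox z
    have hB : HasFDerivAt prox B z := hdiff.hasFDerivAt
    set H : SpaceTime d →L[ℝ] SpaceTime d := (4 * N) • (ContinuousLinearMap.id ℝ _ - B) with hH
    have hGH : HasFDerivAt G H z := ((hasFDerivAt_id z).sub hB).const_smul (4 * N)
    have hBb := hasFDerivAt_prox_bound hN hW hprox hB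
    have hHst : ∀ a, 1 / (4 * N) * stInner (H a) a = ‖a.1‖ ^ 2 + a.2 ^ 2 - stInner a (B a) := by
      intro a
      simp only [hH, smul_apply, sub_apply, map_smul, map_sub, smul_eq_mul,
        ContinuousLinearMap.id_apply]
      rw [← mul_assoc, one_div_mul_cancel (by positivity), one_mul, stInner_comm (B a),
        stInner_apply a a, real_inner_self_eq_norm_sq, sq a.2]
    have hlow : ∀ a, -a.2 ^ 2 ≤ 1 / (4 * N) * stInner (H a) a := by
      intro a
      rw [hHst]
      have h3 := hBb a
      have h4 : stInner a (B a) ≤ ‖a.1‖ * ‖(B a).1‖ + a.2 * (B a).2 := by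
        rw [stInner_apply]
        linarith [real_inner_le_norm a.1 (B a).1]
      nlinarith [sq_nonneg (‖a.1‖ - ‖(B a).1‖), sq_nonneg (2 * a.2 - (B a).2)]
    have hup : 1 / (4 * N) * (H (0, 1)).2 ≤ 1 := by
      have h3 := hBb (0, 1)
      have h4 := hHst (0, 1)
      have h5 : stInner (H (0, 1)) (0, 1) = (H (0, 1)).2 := by simp [stInner_apply]
      rw [h5] at h4
      rw [h4]
      simp only [norm_zero]
      nlinarith [sq_nonneg (B (0, 1)).2, sq_nonneg ‖(B (0, 1)).1‖]
    have htouch : ∀ᶠ y in 𝓝[Q] w, u w + (g (z + (y - w)) - g z) ≤ u y := by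
      refine nhdsWithin_le_nhds ?_
      filter_upwards [mem_interior_iff_mem_nhds.1 hw] with y hy
      have h3 := hprox (z + (y - w)) y
      have h4 := hWle y hy
      simp only [hgdef, h1]
      have e1 : z.1 + (y.1 - w.1) - y.1 = z.1 - w.1 := by abel
      have e2 : z.2 + (y.2 - w.2) - y.2 = z.2 - w.2 := by ring
      simp only [proxObj, Prod.fst_add, Prod.snd_add, Prod.fst_sub, Prod.snd_sub] at h3 ⊢
      rw [e1, e2] at h3
      linarith
    obtain ⟨hsymm, hsub⟩ := isParabolicSubjet_of_touching hg hGH htouch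
    have hpsd : (spatialBlock H).PosSemidef := posSemidef_spatialBlock hsymm fun x => by
      have h3 := hlow (x, 0)
      simp only [ne_eq, OfNat.ofNat_ne_zero, not_false_eq_true, zero_pow, neg_zero] at h3
      exact nonneg_of_mul_nonneg_right h3 (by positivity)
    have hv := hvisc w (hKQ hwK) _ _ _ hsub
    have hF := pucciMax_le_of_posSemidef hle hpsd
    rw [hG1] at hv
    simp only at hv
    have htr0 := mul_nonneg hlam.le hpsd.trace_nonneg
    have htr : (spatialBlock H).trace ≤ 1 / lam := by
      rw [le_div_iff₀ hlam]
      linarith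
    have hq1 : |q| ≤ 1 := by
      rw [abs_of_nonpos hq0]; linarith
    obtain ⟨L, hΦd, hΦL⟩ := exists_hasFDerivAt_slopeHeight N (hg z) hGH
    rw [hG1] at hΦL
    refine ⟨hΦd.differentiableAt, ?_⟩
    rw [hΦd.fderiv]
    refine (abs_det_le_of_hessian_bounds (by positivity) hsymm hlow hup htr q _ hΦL).trans ?_
    exact mul_le_of_le_one_left (by positivity) hq1
  set D := {z | DifferentiableAt ℝ prox z}
  have hD : volume Dᶜ = 0 := (lipschitzWith_prox hN hW hprox).ae_differentiableAt
  -- `S` replaces the set of contact points, which might not be measurable.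
  set S := U ∩ {z | DifferentiableAt ℝ Φ z} ∩
    {z | |(fderiv ℝ Φ z).det| ≤ (1 / lam + 2) ^ (d + 1)} with hS
  have hSm : MeasurableSet S := by
    refine (hU.measurableSet.inter (measurableSet_of_differentiableAt ℝ Φ)).inter ?_
    exact measurableSet_le (ContinuousLinearMap.continuous_det.measurable.comp
      (measurable_fderiv ℝ Φ)).abs measurable_const
  have himage : volume (Φ '' S) ≤ ENNReal.ofReal ((1 / lam + 2) ^ (d + 1)) * volume U := by
    calc volume (Φ '' S) ≤ ∫⁻ z in S, ENNReal.ofReal |(fderiv ℝ Φ z).det| :=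
          addHaar_image_le_lintegral_abs_det_fderiv volume hSm
            fun z hz => (DifferentiableAt.hasFDerivAt hz.1.2).hasFDerivWithinAt
      _ ≤ ∫⁻ _ in S, ENNReal.ofReal ((1 / lam + 2) ^ (d + 1)) :=
          setLIntegral_mono measurable_const fun z hz => ENNReal.ofReal_le_ofReal hz.2
      _ = ENNReal.ofReal ((1 / lam + 2) ^ (d + 1)) * volume S := setLIntegral_const _ _
      _ ≤ _ := by gcongr; exact fun z hz => hz.1.1
  have hsub : {ph : SpaceTime d | ∃ w ∈ interior K, ∃ q : ℝ, q ≤ 0 ∧ ‖ph.1‖ ≤ R ∧ |q| ≤ R ∧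
      (∀ z ∈ K, u w + inner ℝ ph.1 (z.1 - w.1) + q * (z.2 - w.2) - N * (z.2 - w.2) ^ 2 ≤ u z) ∧
      ph.2 = u w - inner ℝ ph.1 w.1 + q ^ 2 / (4 * N) ∧ w + (1 / (4 * N)) • (ph.1, q) ∈ U} ⊆
      Φ '' S ∪ Φ '' Dᶜ := by
    rintro ⟨p, h⟩ ⟨w, hw, q, hq0, hp, hq, hpq, hh, hzU⟩
    have h1 := (hΦcontact w (interior_subset hw) p q hp hq hpq).2
    simp only at hh hzU
    rw [← hh] at h1
    rw [← image_union, ← h1]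
    refine mem_image_of_mem _ ?_
    by_cases hzD : w + (1 / (4 * N)) • (p, q) ∈ D
    · obtain ⟨h2, h3⟩ := hjac w hw p q hq0 hp hq hpq hzD
      exact Or.inl ⟨⟨hzU, h2⟩, h3⟩
    · exact Or.inr hzD
  refine (measure_mono hsub).trans ((measure_union_le _ _).trans ?_)
  rw [volume_image_slopeHeight_eq_zero N (lipschitzWith_prox hN hW hprox) hg hD, add_zero]
  exact himage

/-! ### Removing the penalization -/

theorem measure_setOf_eventually_mem_le {α : Type*} [MeasurableSpace α] (μ : Measure α)
    {s : ℕ → Set α} {c : ℝ≥0∞} (hs : ∀ n, μ (s n) ≤ c) : μ {x | ∀ᶠ n in atTop, x ∈ s n} ≤ c := by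
  have h : {x | ∀ᶠ n in atTop, x ∈ s n} = ⋃ m, ⋂ n ≥ m, s n := by
    ext x
    simp [eventually_atTop]
  have hmono : Monotone fun m => ⋂ n ≥ m, s n := fun a b hab =>
    biInter_mono (fun n (hn : b ≤ n) => hab.trans hn) fun _ _ => le_rfl
  rw [h, hmono.measure_iUnion]
  exact iSup_le fun m => (measure_mono (biInter_subset_of_mem (le_refl m))).trans (hs m)


theorem eq_of_notMem_exceptionalPairs {K : Set (SpaceTime d)} {u : SpaceTime d → ℝ}
    {ph w z : SpaceTime d} (hexc : ph ∉ exceptionalPairs K u) (hw : w ∈ K)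
    (hph : ph ∈ minorants K u w.2) (hwu : u w = inner ℝ ph.1 w.1 + ph.2) (hz : z ∈ K)
    (hzw : z.2 ≤ w.2) (hzu : u z = inner ℝ ph.1 z.1 + ph.2) : z = w := by
  by_contra hne
  refine hexc ?_
  by_cases hx : z.1 = w.1
  · have hlt : z.2 < w.2 := lt_of_le_of_ne hzw fun h => hne (Prod.ext hx h)
    obtain ⟨t, ht1, ht2⟩ := exists_rat_btwn hlt
    refine Or.inr (mem_iUnion.2 ⟨t, antitone_minorants K u ht2.le hph, fun h' hh' hcon => ?_⟩)
    have := hcon z hz ht1.le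
    simp only at this
    linarith
  · exact Or.inl ⟨w.2, hph, z.1, w.1, hx, fun qk hqk => hzu ▸ hqk z hz hzw,
      fun qk hqk => hwu ▸ hqk w hw le_rfl⟩

/-- A pair `(p, h)` touching `u` at `w₀` touches the penalized function `u + N ((t - σ)⁺)²` on all of
`K`, at the same height `h`, for the largest `σ` such that `p · x + h` stays below it; this is the
minimum of `t - √((h - (u - p · x)) / N)` over the points where `u - p · x ≤ h`. Here
`ρ = w.2 - σ`. -/
theorem exists_penalized_contact {K : Set (SpaceTime d)} (hK : IsCompact K) {u : SpaceTime d → ℝ}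
    (hu : ContinuousOn u K) {p : EuclideanSpace ℝ (Fin d)} {h : ℝ} {w₀ : SpaceTime d}
    (hw₀ : w₀ ∈ K) (hwu : u w₀ = inner ℝ p w₀.1 + h) {N : ℝ} (hN : 0 < N) :
    ∃ w ∈ K, ∃ ρ : ℝ, 0 ≤ ρ ∧ w.2 ≤ w₀.2 + ρ ∧ u w = inner ℝ p w.1 + h - N * ρ ^ 2 ∧
      ∀ z ∈ K, u w + inner ℝ p (z.1 - w.1) + (-(2 * N * ρ)) * (z.2 - w.2)
        - N * (z.2 - w.2) ^ 2 ≤ u z := by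
  have hf : ContinuousOn (fun z => h - (u z - inner ℝ p z.1)) K :=
    continuousOn_const.sub (hu.sub (by fun_prop))
  have hZ : IsCompact {z ∈ K | 0 ≤ h - (u z - inner ℝ p z.1)} :=
    hK.of_isClosed_subset (hf.preimage_isClosed_of_isClosed hK.isClosed isClosed_Ici)
      inter_subset_left
  have hk : ContinuousOn (fun z : SpaceTime d => z.2 - √((h - (u z - inner ℝ p z.1)) / N))
      {z ∈ K | 0 ≤ h - (u z - inner ℝ p z.1)} :=
    (continuous_snd.continuousOn).sub ((hf.mono inter_subset_left).div_const N).sqrt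
  obtain ⟨w, ⟨hwK, hwf⟩, hmin⟩ := hZ.exists_isMinOn ⟨w₀, hw₀, by rw [hwu]; simp⟩ hk
  set ρ := √((h - (u w - inner ℝ p w.1)) / N) with hρ
  have hρ2 : N * ρ ^ 2 = h - (u w - inner ℝ p w.1) := by
    rw [hρ, Real.sq_sqrt (by positivity)]
    field_simp
  refine ⟨w, hwK, ρ, Real.sqrt_nonneg _, ?_, by linarith, fun z hz => ?_⟩
  · have h1 : w.2 - ρ ≤ w₀.2 - √((h - (u w₀ - inner ℝ p w₀.1)) / N) :=
      hmin (a := w₀) ⟨hw₀, by rw [hwu]; simp⟩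
    linarith [Real.sqrt_nonneg ((h - (u w₀ - inner ℝ p w₀.1)) / N)]
  · rw [inner_sub_right]
    rcases le_or_gt 0 (h - (u z - inner ℝ p z.1)) with hzf | hzf
    · have h1 : w.2 - ρ ≤ z.2 - √((h - (u z - inner ℝ p z.1)) / N) := hmin (a := z) ⟨hz, hzf⟩
      have h2 : (h - (u z - inner ℝ p z.1)) / N ≤ (z.2 - w.2 + ρ) ^ 2 :=
        Real.sqrt_le_iff.1 (by linarith : √((h - (u z - inner ℝ p z.1)) / N) ≤ _) |>.2
      rw [div_le_iff₀ hN] at h2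
      nlinarith
    · nlinarith [mul_nonneg hN.le (sq_nonneg (z.2 - w.2 + ρ))]

/-- The estimate for a compact set `K`. Off the exceptional pairs the penalized contact points
converge to the original one, so they end up in the interior of `K` and in `U`. -/
theorem volume_minorants_touching_le {lam Lam : ℝ} (hlam : 0 < lam) (hle : lam ≤ Lam)
    {Q K : Set (SpaceTime d)} (hKQ : K ⊆ Q) (hK : IsCompact K) {u : SpaceTime d → ℝ}
    (hu : ContinuousOn u Q) (hvisc : IsViscositySupersolution Q (pucciMax lam Lam) (-1) u)
    {U : Set (SpaceTime d)} (hU : IsOpen U) :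
    volume {ph : SpaceTime d | ∃ w ∈ interior K ∩ U, ph ∈ minorants K u w.2 ∧
      u w = inner ℝ ph.1 w.1 + ph.2} ≤
    ENNReal.ofReal ((1 / lam + 2) ^ (d + 1)) * volume U := by
  have hbound := measure_setOf_eventually_mem_le volume fun n : ℕ =>
    volume_contact_le hlam hle hKQ hK hu hvisc (N := n + 1) n.cast_add_one_pos
      (((n : ℝ) + 1) ^ 2) hU
  refine le_trans (measure_mono fun ph hph => ?_)
    ((measure_union_le (exceptionalPairs K u) _).trans
      ((add_le_add (volume_exceptionalPairs hK.isBounded u).le hbound).trans_eq (zero_add _)))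
  by_cases hexc : ph ∈ exceptionalPairs K u
  · exact Or.inl hexc
  right
  obtain ⟨p, h⟩ := ph
  obtain ⟨w₀, hw₀, hmin, hwu⟩ := hph
  simp only at hwu
  have hw₀K : w₀ ∈ K := interior_subset hw₀.1
  have huK := hu.mono hKQ
  obtain ⟨δ, hδ, hball⟩ := Metric.isOpen_iff.1 (isOpen_interior.inter hU) w₀ hw₀
  have hf : ContinuousOn (fun z => u z - inner ℝ p z.1) K := huK.sub (by fun_prop)
  obtain ⟨B, hB⟩ : ∃ B, ∀ z ∈ K, h - (u z - inner ℝ p z.1) ≤ B := by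
    obtain ⟨m, -, hm⟩ := hK.exists_isMinOn ⟨w₀, hw₀K⟩ hf
    refine ⟨h - (u m - inner ℝ p m.1), fun z hz => ?_⟩
    have h1 : u m - inner ℝ p m.1 ≤ u z - inner ℝ p z.1 := hm hz
    linarith
  have hB0 : 0 ≤ B := by
    have := hB w₀ hw₀K
    rw [hwu] at this
    linarith
  -- By uniqueness of the contact point, points away from `w₀` with `u - p · x ≤ h` lie in the future.
  obtain ⟨η, hη, hηK⟩ : ∃ η > 0, ∀ z ∈ K, z ∉ Metric.ball w₀ (δ / 2) →
      u z - inner ℝ p z.1 ≤ h → w₀.2 + η ≤ z.2 := by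
    have hZ : IsCompact ({z ∈ K | u z - inner ℝ p z.1 ≤ h} \ Metric.ball w₀ (δ / 2)) :=
      (hK.of_isClosed_subset (hf.preimage_isClosed_of_isClosed hK.isClosed isClosed_Iic)
        inter_subset_left).diff Metric.isOpen_ball
    rcases eq_empty_or_nonempty ({z ∈ K | u z - inner ℝ p z.1 ≤ h} \ Metric.ball w₀ (δ / 2)) with
      he | hne
    · refine ⟨1, one_pos, fun z hz hzb hzh => ?_⟩
      have : z ∈ {z ∈ K | u z - inner ℝ p z.1 ≤ h} \ Metric.ball w₀ (δ / 2) := ⟨⟨hz, hzh⟩, hzb⟩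
      rw [he] at this
      exact this.elim
    · obtain ⟨m, ⟨⟨hmK, hmh⟩, hmb⟩, hm⟩ := hZ.exists_isMinOn hne continuous_snd.continuousOn
      have hlt : w₀.2 < m.2 := by
        by_contra! hle'
        have h1 := hmin m hmK hle'
        simp only at h1
        have h2 := eq_of_notMem_exceptionalPairs hexc hw₀K hmin hwu hmK hle'
          (by simp only; linarith)
        exact hmb (h2 ▸ Metric.mem_ball_self (by positivity))
      refine ⟨m.2 - w₀.2, sub_pos.2 hlt, fun z hz hzb hzh => ?_⟩
      have h1 : m.2 ≤ z.2 := hm (a := z) ⟨⟨hz, hzh⟩, hzb⟩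
      linarith
  have hN : Tendsto (fun n : ℕ => (n : ℝ) + 1) atTop atTop :=
    tendsto_atTop_add_const_right _ _ tendsto_natCast_atTop_atTop
  filter_upwards [hN.eventually_gt_atTop (B / η ^ 2), hN.eventually_gt_atTop (B / (δ / 2) ^ 2),
    hN.eventually_gt_atTop (‖p‖ / (δ / 2)), hN.eventually_ge_atTop (2 * (B + 1)),
    hN.eventually_ge_atTop ‖p‖, hN.eventually_ge_atTop 1] with n h1 h2 h3 h4 h5 h6
  set N : ℝ := (n : ℝ) + 1 with hNdef
  have hNpos : 0 < N := by linarith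
  obtain ⟨w, hwK, ρ, hρ, hwρ, huw, hcontact⟩ :=
    exists_penalized_contact hK huK hw₀K hwu hNpos
  have hρB : N * ρ ^ 2 ≤ B := by
    have := hB w hwK
    rw [huw] at this
    linarith
  have hwball : w ∈ Metric.ball w₀ (δ / 2) := by
    by_contra hcon
    have h7 := hηK w hwK hcon (by rw [huw]; nlinarith [mul_nonneg hNpos.le (sq_nonneg ρ)])
    have h8 : η ≤ ρ := by linarith
    rw [div_lt_iff₀ (by positivity)] at h1
    have h9 : η ^ 2 ≤ ρ ^ 2 := pow_le_pow_left₀ hη.le h8 2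
    nlinarith [mul_le_mul_of_nonneg_left h9 hNpos.le]
  have hρδ : ρ < δ / 2 := by
    by_contra! hcon
    rw [div_lt_iff₀ (by positivity)] at h2
    have h9 : (δ / 2) ^ 2 ≤ ρ ^ 2 := pow_le_pow_left₀ (by positivity) hcon 2
    nlinarith [mul_le_mul_of_nonneg_left h9 hNpos.le]
  have hρ1 : ρ ≤ B + 1 := by
    have : ρ ^ 2 ≤ N * ρ ^ 2 := le_mul_of_one_le_left (sq_nonneg ρ) h6
    nlinarith
  have hpδ : ‖p‖ < N * (δ / 2) := by
    rwa [div_lt_iff₀ (by positivity)] at h3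
  have hq : |-(2 * N * ρ)| ≤ N ^ 2 := by
    rw [abs_neg, abs_of_nonneg (by positivity)]
    nlinarith
  refine ⟨w, ?_, -(2 * N * ρ), ?_, ?_, hq, hcontact, ?_, ?_⟩
  · exact (hball (Metric.ball_subset_ball (by linarith) hwball)).1
  · have : 0 ≤ 2 * N * ρ := by positivity
    linarith
  · nlinarith
  · rw [huw]
    field_simp
    ring
  · refine (hball ?_).2
    rw [Metric.mem_ball] at hwball ⊢
    refine lt_of_le_of_lt (dist_triangle _ w _) ?_
    have h7 : dist (w + (1 / (4 * N)) • ((p, -(2 * N * ρ)) : SpaceTime d)) w < δ / 2 := by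
      rw [dist_eq_norm, add_sub_cancel_left, norm_smul, Real.norm_of_nonneg (by positivity),
        one_div, inv_mul_lt_iff₀ (by positivity), Prod.norm_def]
      refine max_lt ?_ ?_
      · simp only
        have : 0 < N * (δ / 2) := by positivity
        linarith
      · simp only [Real.norm_eq_abs]
        rw [abs_neg, abs_of_nonneg (by positivity)]
        nlinarith
    linarith

theorem mem_contactSet_of_touching {Q : Set (SpaceTime d)} {u : SpaceTime d → ℝ}
    {ph w : SpaceTime d} (hw : w ∈ Q) (hph : ph ∈ minorants Q u w.2)
    (hwu : u w = inner ℝ ph.1 w.1 + ph.2) : w ∈ contactSet Q u := by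
  refine ⟨le_antisymm ?_ ?_, hw⟩
  · exact le_sSup ⟨ph.1, ph.2, hph, by rw [hwu]⟩
  · refine sSup_le ?_
    rintro _ ⟨q, k, hqk, rfl⟩
    exact EReal.coe_le_coe_iff.2 (hqk w hw le_rfl)

/-! ### Exhaustion of the domain -/

theorem volume_touching_le {lam Lam : ℝ} (hlam : 0 < lam) (hle : lam ≤ Lam)
    {Q : Set (SpaceTime d)} (hQ : IsOpen Q) (hQb : Bornology.IsBounded Q) {u : SpaceTime d → ℝ}
    (hu : ContinuousOn u Q) (hvisc : IsViscositySupersolution Q (pucciMax lam Lam) (-1) u)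
    {U : Set (SpaceTime d)} (hU : IsOpen U) (hcU : contactSet Q u ⊆ U) :
    volume {ph : SpaceTime d | ∃ w ∈ Q, ph ∈ minorants Q u w.2 ∧
      u w = inner ℝ ph.1 w.1 + ph.2} ≤
    ENNReal.ofReal ((1 / lam + 2) ^ (d + 1)) * volume U := by
  have hne : (Qᶜ).Nonempty := by
    rw [nonempty_compl]
    rintro rfl
    exact NormedSpace.unbounded_univ ℝ (SpaceTime d) hQb
  have hcont : Continuous fun z : SpaceTime d => Metric.infDist z Qᶜ :=
    Metric.continuous_infDist_pt _
  have hpos : ∀ z, z ∈ Q ↔ 0 < Metric.infDist z Qᶜ := fun z => by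
    rw [← hQ.isClosed_compl.notMem_iff_infDist_pos hne, notMem_compl_iff]
  have hKQ : ∀ n : ℕ, {z | 1 / ((n : ℝ) + 1) ≤ Metric.infDist z Qᶜ} ⊆ Q := fun n z hz =>
    (hpos z).2 (lt_of_lt_of_le (by positivity) hz)
  refine (measure_mono ?_).trans (measure_setOf_eventually_mem_le volume fun n : ℕ =>
    volume_minorants_touching_le hlam hle (hKQ n)
      (Metric.isCompact_of_isClosed_isBounded (isClosed_le continuous_const hcont)
        (hQb.subset (hKQ n))) hu hvisc hU)
  rintro ph ⟨w, hw, hph, hwu⟩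
  have hlim : Tendsto (fun n : ℕ => 1 / ((n : ℝ) + 1)) atTop (𝓝 0) :=
    tendsto_one_div_add_atTop_nhds_zero_nat
  filter_upwards [hlim.eventually_lt_const ((hpos w).1 hw)] with n hn
  refine ⟨w, ⟨?_, hcU (mem_contactSet_of_touching hw hph hwu)⟩,
    fun z hz hzw => hph z (hKQ n hz) hzw, hwu⟩
  exact interior_maximal (fun z (hz : _ < _) => le_of_lt hz)
    (isOpen_lt continuous_const hcont) hn

end

theorem lemma2p6 (d : ℕ) (hd : 1 ≤ d) (lam : ℝ) (hlam : 0 < lam) :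
    ∃ C : ℝ≥0, ∀ (Lam : ℝ), lam ≤ Lam →
      ∀ (Q : Set (SpaceTime d)), IsOpen Q → Bornology.IsBounded Q →
      ∀ (u : SpaceTime d → ℝ), ContinuousOn u Q →
        IsViscositySupersolution Q (pucciMax lam Lam) (-1) u →
          volume (parabolicSubdiff Q (monotoneEnvelope Q u) Q)
            ≤ (C : ℝ≥0∞) * volume (contactSet Q u) := by
  refine ⟨((1 / lam + 2) ^ (d + 1)).toNNReal, fun Lam hle Q hQ hQb u hu hvisc => ?_⟩
  refine (measure_mono (parabolicSubdiff_subset hQb hu)).trans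
    ((measure_union_le _ _).trans ?_)
  rw [volume_exceptionalPairs hQb, zero_add, (contactSet Q u).measure_eq_iInf_isOpen volume]
  have h0 : (((1 / lam + 2) ^ (d + 1)).toNNReal : ℝ≥0∞) ≠ 0 :=
    ENNReal.coe_ne_zero.2 (Real.toNNReal_pos.2 (by positivity)).ne'
  simp_rw [ENNReal.mul_iInf_of_ne h0 ENNReal.coe_ne_top]
  exact le_iInf fun U => le_iInf fun hcU => le_iInf fun hU =>
    volume_touching_le hlam hle hQ hQb hu hvisc hU hcU
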